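/- Let $a<b$, $L=b-a$. For $h\in L^1([a,b])$ and $1\le p\le\infty$ put $(\mathcal V h)(x)=\int_a^x h(t)\,dt$, and let $\mathrm C_p(f,g)=\|\mathcal V(f-g)\|_{L^p([a,b])}$ be the $p$-Cramér distance. For an even integer $n\ge 2$ let $t_j=a+jL/n$, $0\le j\le n-1$. For $x\in\mathbb R^n$ define $$\alpha[k]=\frac Ln\sum_{j=0}^{n-1}x[j]e^{-2\pi \mathrm i k t_j/L},\qquad \beta[k]=\frac{\alpha[k]}{2\pi \mathrm i k/L}\ \ (0<|k|<n/2),\qquad \beta[0]=-\sum_{0<|k|<n/2}\beta[k]e^{2\pi \mathrm i k a/L},$$ $$\nu_x(t)=\frac1L\sum_{k=-n/2+1}^{n/2-1}\beta[k]e^{2\pi \mathrm i tk/L},$$ $\mathrm V_p(x)=\big(\frac Ln\sum_{j=0}^{n-1}|\nu_x(t_j)|^p\big)^{1/p}$ for $1\le p<\infty$, and $\mathrm V_\infty(x)=\max_{0\le j\le n-1}|\nu_x(t_j)|$. The discrete Cramér distance of $x,y\in\mathbb R^n$ is $\widehat{\mathrm C}_p(x,y)=\mathrm V_p(x-y)$.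 **Theorem 4.1.** Let $f,g$ be real-valued $C^\infty$ functions on $\mathbb R$ that are supported on $[a,b]$ and satisfy $\int_a^b f=\int_a^b g$. Let $Z[0],Z[1],\dots,\widetilde Z[0],\widetilde Z[1],\dots$ be independent Gaussians (possibly of variance $0$), where $Z[j]$ has mean $0$ and variance $\sigma_j^2$ and $\widetilde Z[j]$ has mean $0$ and variance $\widetilde\sigma_j^2$, and suppose that $\sigma\ge 0$ satisfies $$\frac1n\sum_{j=0}^{n-1}\sigma_j^2+\frac1n\sum_{j=0}^{n-1}\widetilde\sigma_j^2\le\sigma^2\qquad\text{for all even } n\ge 2.$$ Let $X_n,Y_n\in\mathbb R^n$ have entries $X_n[j]=f(t_j)+Z[j]$ and $Y_n[j]=g(t_j)+\widetilde Z[j]$. Constants below depend only on $a,b,f,g$ (not on $p$, $n$, $t$, $\sigma$, the variances or the probability space). Then: 1. (Expected error.) There are $A,B>0$ such that for all $\sigma\ge0$, all even $n\ge2$ and all $1\le p\le\infty$, the error is integrable and $$\mathbb E\left[\left|\widehat{\mathrm C}_p(X_n,Y_n)-\mathrm C_p(f,g)\right|\right]\le A\sigma\frac{\log(n)^{m(p)}}{\sqrt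 n}+\frac Bn,\qquad m(p)=\max\{1/2-1/p,0\}.$$ 2. (Concentration.) There are $A,B,C>0$ such that for all $\sigma>0$, all $t\ge0$ and all even $n\ge 2$ with $nt\ge C$, $$\mathbb P\left(\left|\widehat{\mathrm C}_p(X_n,Y_n)-\mathrm C_p(f,g)\right|\ge t\right)\le A\exp\left(-B\frac{nt^2}{\sigma^2}\right)\quad\text{for } 1\le p\le2,$$ $$\mathbb P\left(\left|\widehat{\mathrm C}_p(X_n,Y_n)-\mathrm C_p(f,g)\right|\ge t\right)\le A\,n\exp\left(-B\frac{nt^2}{\sigma^2}\right)\quad\text{for } 2<p\le\infty.$$ 3. (Almost sure limit.) For all $1\le p\le\infty$, $\widehat{\mathrm C}_p(X_n,Y_n)\to\mathrm C_p(f,g)$ almost surely as $n\to\infty$ through the even integers. -/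

import Mathlib

open MeasureTheory ProbabilityTheory Filter Topology
open scoped ENNReal NNReal

universe u

noncomputable section

/-- The Volterra operator `(𝒱 h)(x) = ∫ₐˣ h(t) dt`. -/
def volterra (a : ℝ) (h : ℝ → ℝ) (x : ℝ) : ℝ := ∫ t in a..x, h t

/-- The Volterra `p`-norm on `[a, b]`: the `L^p([a, b])` norm of the Volterra transform. -/
def volterraNorm (a b : ℝ) (p : ℝ≥0∞) (h : ℝ → ℝ) : ℝ :=
  (eLpNorm (volterra a h) p (volume.restrict (Set.Icc a b))).toReal

/-- The `p`-Cramér distance between functions on `[a, b]`. -/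
def cramerDist (a b : ℝ) (p : ℝ≥0∞) (f g : ℝ → ℝ) : ℝ :=
  volterraNorm a b p (fun t => f t - g t)

/-- The grid points `t_j = a + j L / n`, where `L = b - a`. -/
def gridPoint (a b : ℝ) (n j : ℕ) : ℝ := a + j * (b - a) / n

/-- The exponential `e^{2 π i k t / L}`, where `L = b - a`. -/
def gridExp (a b : ℝ) (k : ℤ) (t : ℝ) : ℂ :=
  Complex.exp (2 * Real.pi * Complex.I * k * t / (b - a : ℝ))

/-- The normalized discrete Fourier coefficients
`α[k] = (L / n) ∑_{j < n} x[j] e^{-2 π i k t_j / L}`. -/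
def fourierCoeffAlpha (a b : ℝ) {n : ℕ} (x : Fin n → ℝ) (k : ℤ) : ℂ :=
  (((b - a) / n : ℝ) : ℂ) * ∑ j : Fin n, (x j : ℂ) * gridExp a b (-k) (gridPoint a b n j)

/-- The integers `k` with `|k| < n / 2` (used for even `n`), that is,
`-n / 2 + 1 ≤ k ≤ n / 2 - 1`. -/
def freqs (n : ℕ) : Finset ℤ := Finset.Ioo (-((n : ℤ) / 2)) ((n : ℤ) / 2)

/-- The value `α[k] / (2 π i k / L)`, which is `β[k]` for `0 < |k| < n / 2`. -/
def fourierCoeffBetaNonzero (a b : ℝ) {n : ℕ} (x : Fin n → ℝ) (k : ℤ) : ℂ :=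
  fourierCoeffAlpha a b x k / (2 * Real.pi * Complex.I * k / (b - a : ℝ))

/-- The coefficients `β[k]`, `|k| < n / 2`:
`β[k] = α[k] / (2 π i k / L)` if `k ≠ 0`, and
`β[0] = - ∑_{0 < |k| < n / 2} β[k] e^{2 π i k a / L}`. -/
def fourierCoeffBeta (a b : ℝ) {n : ℕ} (x : Fin n → ℝ) (k : ℤ) : ℂ :=
  if k = 0 then
    - ∑ l ∈ (freqs n).erase 0, fourierCoeffBetaNonzero a b x l * gridExp a b l a
  else fourierCoeffBetaNonzero a b x k

/-- The trigonometric polynomial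
`ν_x(t) = (1 / L) ∑_{|k| < n / 2} β[k] e^{2 π i t k / L}`. -/
def volterraApprox (a b : ℝ) {n : ℕ} (x : Fin n → ℝ) (t : ℝ) : ℂ :=
  ((1 / (b - a) : ℝ) : ℂ) * ∑ k ∈ freqs n, fourierCoeffBeta a b x k * gridExp a b k t

/-- The discrete Volterra `p`-norm: `((L / n) ∑_{j < n} |ν_x(t_j)|^p)^{1/p}` for finite `p`, and
`max_{j < n} |ν_x(t_j)|` for `p = ∞`. -/
def discreteVolterraNorm (a b : ℝ) (p : ℝ≥0∞) {n : ℕ} (x : Fin n → ℝ) : ℝ :=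
  if p = ∞ then ⨆ j : Fin n, ‖volterraApprox a b x (gridPoint a b n j)‖
  else ((b - a) / n * ∑ j : Fin n, ‖volterraApprox a b x (gridPoint a b n j)‖ ^ p.toReal)
    ^ (1 / p.toReal)

/-- The discrete `p`-Cramér distance between two vectors of length `n`. -/
def discreteCramerDist (a b : ℝ) (p : ℝ≥0∞) {n : ℕ} (x y : Fin n → ℝ) : ℝ :=
  discreteVolterraNorm a b p (x - y)

/-- The exponent `m(p) = max {1/2 - 1/p, 0}`, with `1/∞ = 0`. -/
def logExponent (p : ℝ≥0∞) : ℝ := max (1 / 2 - (1 / p).toReal) 0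

/-- The vector of noisy samples `h(t_j) + Z[j]`, `0 ≤ j < n`. -/
def noisySamples {Ω : Type u} (a b : ℝ) (h : ℝ → ℝ) (Z : ℕ → Ω → ℝ) (n : ℕ) (ω : Ω) :
    Fin n → ℝ :=
  fun j => h (gridPoint a b n j) + Z j ω

/-- `Z[0], Z[1], …, Z'[0], Z'[1], …` are (jointly) independent centered Gaussians, `Z[j]` has
variance `s j ^ 2`, `Z'[j]` has variance `s' j ^ 2` (variance zero is allowed), and the sum of the
two average variances of the first `n` terms is at most `σ ^ 2`, for all admissible (that is,
even and positive) lengths `n`. -/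
structure IsHeteroscedasticNoise {Ω : Type u} [MeasurableSpace Ω] (P : Measure Ω)
    (Z Z' : ℕ → Ω → ℝ) (s s' : ℕ → ℝ≥0) (σ : ℝ) : Prop where
  law : ∀ j, HasLaw (Z j) (gaussianReal 0 (s j ^ 2)) P
  law' : ∀ j, HasLaw (Z' j) (gaussianReal 0 (s' j ^ 2)) P
  indep : iIndepFun (Sum.elim Z Z') P
  average_le : ∀ n : ℕ, 2 ≤ n → Even n →
    1 / (n : ℝ) * ∑ j ∈ Finset.range n, (s j : ℝ) ^ 2
      + 1 / (n : ℝ) * ∑ j ∈ Finset.range n, (s' j : ℝ) ^ 2 ≤ σ ^ 2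

/-- The error `|Ĉ_p(X_n, Y_n) - C_p(f, g)|`, where `X_n[j] = f(t_j) + Z[j]` and
`Y_n[j] = g(t_j) + Z'[j]`. -/
def cramerError {Ω : Type u} (a b : ℝ) (f g : ℝ → ℝ) (Z Z' : ℕ → Ω → ℝ) (p : ℝ≥0∞) (n : ℕ)
    (ω : Ω) : ℝ :=
  |discreteCramerDist a b p (noisySamples a b f Z n ω) (noisySamples a b g Z' n ω)
    - cramerDist a b p f g|

end

/-!
The discrete Volterra transform is linear, `ν_x(t) = ∑_j x[j] K(t, t_j)`, with a real kernel `K`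
that is a difference of two partial sums of the sawtooth series `∑ sin (k θ) / k`, times `L / (π n)`.
These partial sums are uniformly bounded (`abs_sineSum_le`), so `|K| ≤ 3 L / n`
(`abs_volterraKernel_le`). Both the deterministic and the random part of the error are governed by
this one bound.

*Deterministic part.* With `h = f - g`, the transform of the samples of `h` differs from `𝒱 h` by
`O(1 / n)` on the grid (`exists_norm_volterraApprox_sub_le`). By discrete orthogonality the transform
integrates exponentials of nonzero frequency below `n / 2` exactly; the Fourier coefficients of `h`
decay rapidly and its mean vanishes, so `h` is uniformly `O(1 / n)`-close to a combination of such
exponentials; and on the remainder both operators are bounded in the uniform norm. A discrete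
`p`-norm is the `L^p([a, b])` norm of a step function (`toReal_eLpNorm_comp_cellIndex`), so
Minkowski's inequality compares it with the norm of the Lipschitz function `𝒱 h`. Hence the error is
at most the discrete `p`-norm of the transformed noise plus `B / n`, with `B` independent of `p`
(`exists_cramerError_le`).

*Random part.* Each value `w_j` of the transformed noise is a centered Gaussian of variance at most
`9 L² σ² / n`. With `λ = n / (36 L² σ²)`, the mean `Q = (1 / n) ∑_j exp (λ |w_j|²)` has
`𝔼 Q ≤ 2` (`integrable_expSqMean_noiseTransform`), without any use of the dependence between the
`w_j`. Pathwise, with `M = max 1 L`, Jensen's inequality gives `exp (λ (‖w‖_p / M)²) ≤ Q` for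
`p ≤ 2`, the maximal term gives `exp (λ (‖w‖_p / M)²) ≤ n Q` for all `p`, and interpolation between
the two gives `‖w‖_p ≤ M λ^{-1/2} (log n)^{m(p)} (1 + 2 Q)` (`gridNorm_le_mul_expSqMean`). Taking
expectations yields the bound on the expected error, Markov's inequality for `Q` yields
concentration, and the Borel–Cantelli lemma yields the almost sure limit.
-/

noncomputable section

/-! ### Partial sums of the sawtooth series -/

/-- The partial sum `∑_{1 ≤ k ≤ m} sin (k θ) / k` of the sawtooth series. -/
def sineSum (m : ℕ) (θ : ℝ) : ℝ :=
  ∑ k ∈ Finset.range m, Real.sin ((k + 1 : ℝ) * θ) / (k + 1)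

lemma abs_sin_nat_mul_le (k : ℕ) (θ : ℝ) : |Real.sin (k * θ)| ≤ k * |Real.sin θ| := by
  induction k with
  | zero => simp
  | succ k ih =>
    have h1 := Real.abs_cos_le_one (k * θ)
    have h2 := Real.abs_cos_le_one θ
    have h3 := abs_nonneg (Real.sin θ)
    have h4 := abs_nonneg (Real.sin (k * θ))
    push_cast
    rw [add_mul, one_mul, Real.sin_add]
    calc _ ≤ |Real.sin (k * θ) * Real.cos θ| + |Real.cos (k * θ) * Real.sin θ| := abs_add_le _ _
      _ ≤ |Real.sin (k * θ)| + |Real.sin θ| := by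
        rw [abs_mul, abs_mul]
        nlinarith
      _ ≤ _ := by linarith

/-- The conjugate Dirichlet kernel, by telescoping. -/
lemma two_mul_sin_half_mul_sum_sin (m : ℕ) (θ : ℝ) :
    2 * Real.sin (θ / 2) * ∑ k ∈ Finset.range m, Real.sin ((k + 1 : ℝ) * θ)
      = Real.cos (θ / 2) - Real.cos (m * θ + θ / 2) := by
  induction m with
  | zero => simp
  | succ m ih =>
    rw [Finset.sum_range_succ, mul_add, ih]
    have h1 : (m : ℝ) * θ + θ / 2 = (m + 1 : ℝ) * θ - θ / 2 := by ring
    push_cast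
    rw [h1, Real.cos_sub, Real.cos_add]
    ring

lemma abs_sum_sin_le (m : ℕ) (θ : ℝ) (h : Real.sin (θ / 2) ≠ 0) :
    |∑ k ∈ Finset.range m, Real.sin ((k + 1 : ℝ) * θ)| ≤ 1 / |Real.sin (θ / 2)| := by
  have hs : 0 < |Real.sin (θ / 2)| := abs_pos.2 h
  rw [le_div_iff₀ hs, mul_comm, ← abs_mul]
  have := two_mul_sin_half_mul_sum_sin m θ
  have h1 := abs_le.1 (Real.abs_cos_le_one (θ / 2))
  have h2 := abs_le.1 (Real.abs_cos_le_one (m * θ + θ / 2))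
  rw [abs_le]
  constructor <;> linarith

/-- Abel's inequality: the sum of `w k * c k` over `m ≤ k < N` is at most `2 B w m`, where `w ≥ 0`
is antitone and `B` bounds the partial sums of `c`. -/
lemma abs_sum_Ico_mul_le {w c : ℕ → ℝ} {B : ℝ} (hw : Antitone w) (hw0 : ∀ k, 0 ≤ w k)
    (hB : ∀ k, |∑ i ∈ Finset.range k, c i| ≤ B) {m N : ℕ} (hmN : m ≤ N) :
    |∑ k ∈ Finset.Ico m N, w k * c k| ≤ 2 * B * w m := by
  have key : |∑ k ∈ Finset.Ico m N, w k * c k - w N * ∑ i ∈ Finset.range N, c i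
      + w m * ∑ i ∈ Finset.range m, c i| ≤ B * (w m - w N) := by
    induction N, hmN using Nat.le_induction with
    | base => simp
    | succ N hN ih =>
      rw [Finset.sum_Ico_succ_top hN]
      have h1 : |(w N - w (N + 1)) * ∑ i ∈ Finset.range (N + 1), c i| ≤ (w N - w (N + 1)) * B := by
        rw [abs_mul, abs_of_nonneg (sub_nonneg.2 (hw N.le_succ))]
        exact mul_le_mul_of_nonneg_left (hB _) (sub_nonneg.2 (hw N.le_succ))
      rw [Finset.sum_range_succ] at h1 ⊢
      rw [abs_le] at *
      constructor <;> linarith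
  have h1 : |w N * ∑ i ∈ Finset.range N, c i| ≤ w N * B := by
    rw [abs_mul, abs_of_nonneg (hw0 N)]
    exact mul_le_mul_of_nonneg_left (hB _) (hw0 N)
  have h2 : |w m * ∑ i ∈ Finset.range m, c i| ≤ w m * B := by
    rw [abs_mul, abs_of_nonneg (hw0 m)]
    exact mul_le_mul_of_nonneg_left (hB _) (hw0 m)
  rw [abs_le] at *
  constructor <;> linarith

/-- The partial sums of the sawtooth series are uniformly bounded. With `s = |sin (θ / 2)|`, the
terms up to `M = ⌊1 / s⌋` are each at most `2 s`, and Abel's inequality bounds the others. -/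
lemma abs_sineSum_le (m : ℕ) (θ : ℝ) : |sineSum m θ| ≤ 4 := by
  set s := |Real.sin (θ / 2)| with hs
  have hs0 : 0 ≤ s := abs_nonneg _
  have hsin : |Real.sin θ| ≤ 2 * s := by
    have : Real.sin θ = 2 * Real.sin (θ / 2) * Real.cos (θ / 2) := by
      rw [← Real.sin_two_mul]; ring_nf
    rw [this, abs_mul, abs_mul, abs_two]
    have := Real.abs_cos_le_one (θ / 2)
    nlinarith
  have hterm : ∀ k : ℕ, |Real.sin ((k + 1 : ℝ) * θ) / (k + 1)| ≤ 2 * s := by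
    intro k
    have h1 := abs_sin_nat_mul_le (k + 1) θ
    push_cast at h1
    have hk : (0 : ℝ) < k + 1 := by positivity
    rw [abs_div, abs_of_pos hk, div_le_iff₀ hk]
    nlinarith
  have hhead : ∀ M : ℕ, |sineSum M θ| ≤ M * (2 * s) := by
    intro M
    refine (Finset.abs_sum_le_sum_abs _ _).trans ?_
    refine (Finset.sum_le_sum fun k _ => hterm k).trans ?_
    simp
  -- If `s = 0`, every term vanishes.
  rcases hs0.eq_or_lt with h0 | hpos
  · refine (hhead m).trans ?_
    rw [← h0]; norm_num
  have hMs : ((⌊1 / s⌋₊ : ℕ) : ℝ) * s ≤ 1 := by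
    have := Nat.floor_le (by positivity : 0 ≤ 1 / s)
    rwa [le_div_iff₀ hpos] at this
  set M := ⌊1 / s⌋₊ with hM
  rcases le_total m M with hmM | hMm
  · refine (hhead m).trans ?_
    have : (m : ℝ) ≤ M := by exact_mod_cast hmM
    nlinarith
  · have hsplit : sineSum m θ = sineSum M θ
        + ∑ k ∈ Finset.Ico M m, (1 / (k + 1 : ℝ)) * Real.sin ((k + 1 : ℝ) * θ) := by
      rw [sineSum, sineSum, ← Finset.sum_range_add_sum_Ico _ hMm]
      congr 1
      exact Finset.sum_congr rfl fun k _ => by ring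
    have htail := abs_sum_Ico_mul_le (w := fun k : ℕ => 1 / (k + 1 : ℝ))
      (c := fun k : ℕ => Real.sin ((k + 1 : ℝ) * θ)) (B := 1 / s)
      (fun i j hij => by
        have : (i : ℝ) ≤ j := by exact_mod_cast hij
        simp only
        gcongr) (fun k => by positivity)
      (fun k => abs_sum_sin_le k θ (abs_pos.1 hpos)) hMm
    have h1 : 1 / s < M + 1 := Nat.lt_floor_add_one _
    have h2 : 2 * (1 / s) * (1 / (M + 1 : ℝ)) ≤ 2 := by
      rw [mul_one_div, div_le_iff₀ (by positivity)]
      linarith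
    have h3 := hhead M
    rw [hsplit]
    refine (abs_add_le _ _).trans ?_
    nlinarith

/-! ### The kernel of the discrete Volterra operator -/

/-- The kernel `K` with `ν_x(t) = ∑_j x[j] K(t, t_j)`. -/
def volterraKernel (a b : ℝ) (n : ℕ) (t s : ℝ) : ℝ :=
  (b - a) / (Real.pi * n) * (sineSum (n / 2 - 1) (2 * Real.pi * (t - s) / (b - a))
    - sineSum (n / 2 - 1) (2 * Real.pi * (a - s) / (b - a)))

lemma abs_volterraKernel_le {a b : ℝ} (hab : a < b) {n : ℕ} (hn : 0 < n) (t s : ℝ) :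
    |volterraKernel a b n t s| ≤ 3 * (b - a) / n := by
  have hL : 0 < b - a := sub_pos.2 hab
  have hn' : (0 : ℝ) < n := by exact_mod_cast hn
  have hpi := Real.pi_gt_three
  rw [volterraKernel, abs_mul, abs_of_pos (by positivity)]
  have h1 := abs_sineSum_le (n / 2 - 1) (2 * Real.pi * (t - s) / (b - a))
  have h2 := abs_sineSum_le (n / 2 - 1) (2 * Real.pi * (a - s) / (b - a))
  have h3 := abs_sub (sineSum (n / 2 - 1) (2 * Real.pi * (t - s) / (b - a)))
    (sineSum (n / 2 - 1) (2 * Real.pi * (a - s) / (b - a)))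
  calc _ ≤ (b - a) / (Real.pi * n) * 8 := by gcongr; linarith
    _ ≤ (b - a) / (3 * n) * 8 := by gcongr
    _ ≤ _ := by
      rw [div_mul_eq_mul_div, div_le_div_iff₀ (by positivity) hn']
      have : 0 < (b - a) * n := by positivity
      nlinarith

lemma gridExp_zero (a b t : ℝ) : gridExp a b 0 t = 1 := by simp [gridExp]

lemma gridExp_mul_gridExp_neg (a b : ℝ) (k : ℤ) (t s : ℝ) :
    gridExp a b k t * gridExp a b (-k) s = gridExp a b k (t - s) := by
  rw [gridExp, gridExp, gridExp, ← Complex.exp_add]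
  congr 1
  push_cast
  ring

lemma norm_gridExp (a b : ℝ) (k : ℤ) (t : ℝ) : ‖gridExp a b k t‖ = 1 := by
  rw [gridExp, show (2 * Real.pi * Complex.I * k * t / (b - a : ℝ) : ℂ)
    = ((2 * Real.pi * k * t / (b - a) : ℝ) : ℂ) * Complex.I by push_cast; ring]
  exact Complex.norm_exp_ofReal_mul_I _

lemma gridExp_sub_gridExp_neg (a b : ℝ) (k : ℤ) (t : ℝ) :
    gridExp a b k t - gridExp a b (-k) t
      = 2 * Complex.I * (Real.sin (k * (2 * Real.pi * t / (b - a))) : ℂ) := by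
  rw [gridExp, gridExp, Complex.ofReal_sin, Complex.sin]
  rw [show (2 * Real.pi * Complex.I * k * t / (b - a : ℝ) : ℂ)
    = ((k * (2 * Real.pi * t / (b - a)) : ℝ) : ℂ) * Complex.I by push_cast; ring,
    show (2 * Real.pi * Complex.I * (-k : ℤ) * t / (b - a : ℝ) : ℂ)
    = -((k * (2 * Real.pi * t / (b - a)) : ℝ) : ℂ) * Complex.I by push_cast; ring]
  linear_combination (-(Complex.exp (-((k * (2 * Real.pi * t / (b - a)) : ℝ) : ℂ) * Complex.I)
    - Complex.exp (((k * (2 * Real.pi * t / (b - a)) : ℝ) : ℂ) * Complex.I))) * Complex.I_sq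

lemma mem_freqs_erase_iff {n : ℕ} {k : ℤ} :
    k ∈ (freqs n).erase 0 ↔ k ≠ 0 ∧ -((n : ℤ) / 2) < k ∧ k < (n : ℤ) / 2 := by
  simp [freqs]

lemma sum_freqs_erase_zero {M : Type*} [AddCommMonoid M] (n : ℕ) (F : ℤ → M) :
    ∑ k ∈ (freqs n).erase 0, F k
      = ∑ k ∈ Finset.range (n / 2 - 1), (F (k + 1) + F (-(k + 1))) := by
  have hsplit : (freqs n).erase 0 = (Finset.range (n / 2 - 1)).image (fun k : ℕ => ((k : ℤ) + 1))
      ∪ (Finset.range (n / 2 - 1)).image (fun k : ℕ => -((k : ℤ) + 1)) := by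
    ext k
    simp only [mem_freqs_erase_iff, Finset.mem_union, Finset.mem_image, Finset.mem_range]
    constructor
    · rintro ⟨h0, h1, h2⟩
      rcases lt_or_gt_of_ne h0 with h | h
      · exact Or.inr ⟨(-k - 1).toNat, by omega, by omega⟩
      · exact Or.inl ⟨(k - 1).toNat, by omega, by omega⟩
    · rintro (⟨j, hj, rfl⟩ | ⟨j, hj, rfl⟩) <;> omega
  rw [hsplit, Finset.sum_union, Finset.sum_image, Finset.sum_image, Finset.sum_add_distrib]
  · intro i _ j _ h; simpa using h
  · intro i _ j _ h; simpa using h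
  · rw [Finset.disjoint_left]
    intro k hk hk'
    simp only [Finset.mem_image] at hk hk'
    obtain ⟨i, _, rfl⟩ := hk
    obtain ⟨j, _, hj⟩ := hk'
    omega

/-- The kernel in exponential form. -/
lemma volterraKernel_eq_sum_gridExp {a b : ℝ} (hab : a < b) {n : ℕ} (t s : ℝ) :
    (volterraKernel a b n t s : ℂ) = (1 / n : ℂ) * ∑ k ∈ (freqs n).erase 0,
      (b - a : ℝ) / (2 * Real.pi * Complex.I * k)
        * ((gridExp a b k t - gridExp a b k a) * gridExp a b (-k) s) := by
  have hL : ((b - a : ℝ) : ℂ) ≠ 0 := by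
    exact_mod_cast (sub_pos.2 hab).ne'
  have hpi : (Real.pi : ℂ) ≠ 0 := by exact_mod_cast Real.pi_ne_zero
  rw [sum_freqs_erase_zero, volterraKernel, sineSum, sineSum, ← Finset.sum_sub_distrib,
    Complex.ofReal_mul, Complex.ofReal_sum, Finset.mul_sum, Finset.mul_sum]
  refine Finset.sum_congr rfl fun k _ => ?_
  have hk : ((k : ℂ) + 1) ≠ 0 := by exact_mod_cast k.succ_ne_zero
  have h1 := gridExp_sub_gridExp_neg a b (k + 1) (t - s)
  have h2 := gridExp_sub_gridExp_neg a b (k + 1) (a - s)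
  simp only [sub_mul, gridExp_mul_gridExp_neg]
  push_cast at h1 h2 ⊢
  set S1 := Complex.sin ((k + 1) * (2 * Real.pi * (t - s) / (b - a)))
  set S2 := Complex.sin ((k + 1) * (2 * Real.pi * (a - s) / (b - a)))
  rw [sub_eq_iff_eq_add] at h1 h2
  rw [h1, h2]
  rcases eq_or_ne (n : ℂ) 0 with hn | hn
  · simp [hn]
  field_simp
  ring

lemma volterraApprox_eq_sum_kernel {a b : ℝ} (hab : a < b) {n : ℕ} (hn : 2 ≤ n)
    (x : Fin n → ℝ) (t : ℝ) :
    volterraApprox a b x t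
      = ∑ j : Fin n, (x j : ℂ) * (volterraKernel a b n t (gridPoint a b n j) : ℂ) := by
  have hL : ((b - a : ℝ) : ℂ) ≠ 0 := by
    exact_mod_cast (sub_pos.2 hab).ne'
  have h0 : (0 : ℤ) ∈ freqs n := by
    simp only [freqs, Finset.mem_Ioo]; omega
  have h1 : ∑ k ∈ freqs n, fourierCoeffBeta a b x k * gridExp a b k t
      = ∑ k ∈ (freqs n).erase 0, fourierCoeffBetaNonzero a b x k
          * (gridExp a b k t - gridExp a b k a) := by
    rw [← Finset.add_sum_erase _ _ h0, gridExp_zero, mul_one, fourierCoeffBeta, if_pos rfl,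
      ← Finset.sum_neg_distrib, ← Finset.sum_add_distrib]
    refine Finset.sum_congr rfl fun k hk => ?_
    rw [fourierCoeffBeta, if_neg (Finset.ne_of_mem_erase hk)]
    ring
  rw [volterraApprox, h1]
  simp only [volterraKernel_eq_sum_gridExp hab, fourierCoeffBetaNonzero, fourierCoeffAlpha,
    Finset.mul_sum, Finset.sum_mul, Finset.sum_div]
  rw [Finset.sum_comm]
  refine Finset.sum_congr rfl fun j _ => Finset.sum_congr rfl fun k hk => ?_
  have hk : (k : ℂ) ≠ 0 := by exact_mod_cast Finset.ne_of_mem_erase hk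
  have hpi : (Real.pi : ℂ) ≠ 0 := by exact_mod_cast Real.pi_ne_zero
  have hn' : (n : ℂ) ≠ 0 := by exact_mod_cast (by omega : n ≠ 0)
  push_cast at hL ⊢
  field_simp

/-! ### Exactness on trigonometric polynomials -/

/-- Discrete orthogonality of the exponentials on the grid. -/
lemma sum_gridExp_gridPoint_eq_zero {a b : ℝ} (hab : a < b) {n : ℕ} {q : ℤ} (hq : ¬ (n : ℤ) ∣ q) :
    ∑ j : Fin n, gridExp a b q (gridPoint a b n j) = 0 := by
  have hL : ((b - a : ℝ) : ℂ) ≠ 0 := by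
    exact_mod_cast (sub_pos.2 hab).ne'
  rcases Nat.eq_zero_or_pos n with rfl | hn
  · simp
  have hn' : (n : ℂ) ≠ 0 := by exact_mod_cast hn.ne'
  set ζ : ℂ := Complex.exp (2 * Real.pi * Complex.I * q / n) with hζ
  have hpow : ∀ j : ℕ, gridExp a b q (gridPoint a b n j) = gridExp a b q a * ζ ^ j := by
    intro j
    rw [gridExp, gridExp, hζ, ← Complex.exp_nat_mul, ← Complex.exp_add, gridPoint]
    congr 1
    push_cast at hL ⊢
    field_simp
  have h1 : ζ ^ n = 1 := by
    rw [hζ, ← Complex.exp_nat_mul, Complex.exp_eq_one_iff]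
    exact ⟨q, by field_simp⟩
  have h2 : ζ ≠ 1 := by
    rw [hζ, Ne, Complex.exp_eq_one_iff]
    rintro ⟨m, hm⟩
    apply hq
    refine ⟨m, ?_⟩
    have hpi : (Real.pi : ℂ) ≠ 0 := by exact_mod_cast Real.pi_ne_zero
    have hI := Complex.I_ne_zero
    field_simp at hm
    exact_mod_cast hm
  simp only [hpow, ← Finset.mul_sum]
  rw [Fin.sum_univ_eq_sum_range (fun j => ζ ^ j) n, geom_sum_eq h2, h1]
  simp

/-- The discrete Volterra operator integrates exactly the exponentials of nonzero frequency below
`n / 2`. -/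
lemma sum_gridExp_mul_volterraKernel {a b : ℝ} (hab : a < b) {n : ℕ} {q : ℤ}
    (hq : q ∈ (freqs n).erase 0) (t : ℝ) :
    ∑ j : Fin n, gridExp a b q (gridPoint a b n j)
        * (volterraKernel a b n t (gridPoint a b n j) : ℂ)
      = (b - a : ℝ) / (2 * Real.pi * Complex.I * q) * (gridExp a b q t - gridExp a b q a) := by
  have hq' := mem_freqs_erase_iff.1 hq
  have hn : n ≠ 0 := by rintro rfl; simp at hq'; omega
  have hn' : (n : ℂ) ≠ 0 := by exact_mod_cast hn
  simp only [volterraKernel_eq_sum_gridExp hab, Finset.mul_sum]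
  rw [Finset.sum_comm]
  have hk : ∀ k ∈ (freqs n).erase 0, ∑ j : Fin n, gridExp a b q (gridPoint a b n j)
      * ((1 / n : ℂ) * ((b - a : ℝ) / (2 * Real.pi * Complex.I * k)
        * ((gridExp a b k t - gridExp a b k a) * gridExp a b (-k) (gridPoint a b n j))))
      = if k = q then (b - a : ℝ) / (2 * Real.pi * Complex.I * q)
        * (gridExp a b q t - gridExp a b q a) else 0 := by
    intro k hk
    have h1 : ∀ j : Fin n, gridExp a b q (gridPoint a b n j)
      * ((1 / n : ℂ) * ((b - a : ℝ) / (2 * Real.pi * Complex.I * k)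
        * ((gridExp a b k t - gridExp a b k a) * gridExp a b (-k) (gridPoint a b n j))))
      = ((1 / n : ℂ) * ((b - a : ℝ) / (2 * Real.pi * Complex.I * k)
        * (gridExp a b k t - gridExp a b k a))) * gridExp a b (q - k) (gridPoint a b n j) := by
      intro j
      have : gridExp a b (q - k) (gridPoint a b n j)
          = gridExp a b q (gridPoint a b n j) * gridExp a b (-k) (gridPoint a b n j) := by
        rw [gridExp, gridExp, gridExp, ← Complex.exp_add]
        congr 1
        push_cast
        ring
      rw [this]
      ring
    simp only [h1, ← Finset.mul_sum]
    split_ifs with h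
    · subst h
      simp only [sub_self, gridExp_zero, Finset.sum_const, Finset.card_univ, Fintype.card_fin,
        nsmul_eq_mul, mul_one]
      field_simp
    · rw [sum_gridExp_gridPoint_eq_zero hab, mul_zero]
      have hk' := mem_freqs_erase_iff.1 hk
      intro hd
      have := Int.eq_zero_of_abs_lt_dvd hd (by rw [abs_lt]; omega)
      omega
  rw [Finset.sum_congr rfl hk, Finset.sum_ite_eq' , if_pos hq]

/-! ### Accuracy of the discrete Volterra operator -/

lemma eq_zero_of_support_subset_Icc {a b : ℝ} {φ : ℝ → ℂ} (hφ : Continuous φ)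
    (hs : Function.support φ ⊆ Set.Icc a b) : φ a = 0 ∧ φ b = 0 := by
  have h1 : Function.support φ ⊆ Set.Ioo a b := by
    rw [← interior_Icc]
    exact interior_maximal hs hφ.isOpen_support
  constructor <;> by_contra h
  · exact lt_irrefl _ (h1 h).1
  · exact lt_irrefl _ (h1 h).2

lemma support_deriv_subset_Icc {a b : ℝ} {φ : ℝ → ℂ} (hs : Function.support φ ⊆ Set.Icc a b) :
    Function.support (deriv φ) ⊆ Set.Icc a b :=
  support_deriv_subset.trans (closure_minimal hs isClosed_Icc)

lemma exists_norm_fourierCoeffOn_le {a b : ℝ} (hab : a < b) {φ : ℝ → ℂ} (hφ : Continuous φ) :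
    ∃ M : ℝ, 0 ≤ M ∧ ∀ k : ℤ, ‖fourierCoeffOn hab φ k‖ ≤ M := by
  have hL : 0 < b - a := sub_pos.2 hab
  have := Fact.mk hL
  obtain ⟨M, hM⟩ := (isCompact_Icc (a := a) (b := b)).exists_bound_of_continuousOn hφ.continuousOn
  refine ⟨M, (norm_nonneg _).trans (hM a ⟨le_rfl, hab.le⟩), fun k => ?_⟩
  rw [fourierCoeffOn_eq_integral, norm_smul, Real.norm_of_nonneg (by positivity)]
  have h1 : ‖∫ x in a..b, fourier (-k) (x : AddCircle (b - a)) • φ x‖ ≤ M * |b - a| := by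
    refine intervalIntegral.norm_integral_le_of_norm_le_const fun x hx => ?_
    rw [Set.uIoc_of_le hab.le] at hx
    rw [norm_smul, fourier_coe_apply, ← gridExp, norm_gridExp, one_mul]
    exact hM x ⟨hx.1.le, hx.2⟩
  rw [abs_of_pos hL] at h1
  calc _ ≤ 1 / (b - a) * (M * (b - a)) := by gcongr
    _ = M := by field_simp

/-- Repeated integration by parts: the Fourier coefficients of a smooth function supported in one
period decay faster than any power. -/
lemma exists_norm_fourierCoeffOn_le_div_pow {a b : ℝ} (hab : a < b) (m : ℕ) :
    ∀ {φ : ℝ → ℂ}, ContDiff ℝ (⊤ : ℕ∞) φ → Function.support φ ⊆ Set.Icc a b →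
    ∃ M : ℝ, 0 ≤ M ∧ ∀ k : ℤ, k ≠ 0 → ‖fourierCoeffOn hab φ k‖ ≤ M / |(k : ℝ)| ^ m := by
  have hL : 0 < b - a := sub_pos.2 hab
  induction m with
  | zero =>
    intro φ hφ _
    obtain ⟨M, hM0, hM⟩ := exists_norm_fourierCoeffOn_le hab hφ.continuous
    exact ⟨M, hM0, fun k _ => by simpa using hM k⟩
  | succ m ih =>
    intro φ hφ hs
    have hd := contDiff_infty_iff_deriv.1 hφ
    obtain ⟨M, hM0, hM⟩ := ih hd.2 (support_deriv_subset_Icc hs)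
    refine ⟨(b - a) * M, by positivity, fun k hk => ?_⟩
    obtain ⟨ha, hb⟩ := eq_zero_of_support_subset_Icc hφ.continuous hs
    rw [fourierCoeffOn_of_hasDerivAt hab hk (fun x _ => (hd.1 x).hasDerivAt)
      (hd.2.continuous.intervalIntegrable _ _), ha, hb]
    have hk' : 0 < |(k : ℝ)| := abs_pos.2 (by exact_mod_cast hk)
    have hpi := Real.pi_gt_three
    have hcast : ((b : ℂ) - a) = ((b - a : ℝ) : ℂ) := by push_cast; rfl
    rw [sub_zero, mul_zero, zero_sub, norm_mul, norm_neg, norm_mul, hcast, Complex.norm_real,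
      Real.norm_of_nonneg hL.le]
    have h1 : ‖(1 / (-2 * Real.pi * Complex.I * k) : ℂ)‖ = 1 / (2 * Real.pi * |(k : ℝ)|) := by
      simp [abs_of_pos Real.pi_pos]
    rw [h1]
    calc _ ≤ 1 / |(k : ℝ)| * ((b - a) * (M / |(k : ℝ)| ^ m)) := by
          gcongr
          · nlinarith
          · exact hM k hk
      _ = _ := by rw [pow_succ]; field_simp

lemma hasSum_fourierCoeffOn_mul_gridExp {a b : ℝ} (hab : a < b) {φ : ℝ → ℂ}
    (hφ : ContDiff ℝ (⊤ : ℕ∞) φ) (hs : Function.support φ ⊆ Set.Icc a b) {t : ℝ}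
    (ht : t ∈ Set.Ico a b) :
    HasSum (fun k : ℤ => fourierCoeffOn hab φ k * gridExp a b k t) (φ t) := by
  have hL : 0 < b - a := sub_pos.2 hab
  have := Fact.mk hL
  obtain ⟨ha, hb⟩ := eq_zero_of_support_subset_Icc hφ.continuous hs
  have hper : φ a = φ (a + (b - a)) := by rw [add_sub_cancel, ha, hb]
  let ψ : C(AddCircle (b - a), ℂ) := ⟨AddCircle.liftIoc (b - a) a φ,
    AddCircle.liftIoc_continuous hper hφ.continuous.continuousOn⟩
  have hcoe : fourierCoeff ψ = fourierCoeffOn hab φ := rfl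
  have hsum : Summable (fourierCoeff ψ) := by
    rw [hcoe]
    obtain ⟨M, hM0, hM⟩ := exists_norm_fourierCoeffOn_le_div_pow hab 2 hφ hs
    have h1 : Summable fun k : ℤ => M * (1 / (k : ℝ) ^ 2) :=
      (Real.summable_one_div_int_pow.2 one_lt_two).mul_left M
    refine Summable.of_norm_bounded_eventually h1 ?_
    refine (Set.finite_singleton (0 : ℤ)).subset fun k hk => ?_
    by_contra h0
    refine hk ((hM k h0).trans_eq ?_)
    rw [sq_abs, mul_one_div]
  have := has_pointwise_sum_fourier_series_of_summable hsum (t : AddCircle (b - a))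
  rw [hcoe] at this
  have hval : ψ (t : AddCircle (b - a)) = φ t := by
    change AddCircle.liftIoc (b - a) a φ t = φ t
    rw [AddCircle.liftIoc_eq_liftIco hper, AddCircle.liftIco_coe_apply]
    rwa [add_sub_cancel]
  rw [hval] at this
  simpa only [smul_eq_mul, fourier_coe_apply, gridExp] using this

/-- A smooth function of mean zero supported in `[a, b]` is approximated uniformly, at rate
`1 / n`, by trigonometric polynomials of mean zero and degree below `n / 2`. -/
lemma exists_trigPolynomial_approx {a b : ℝ} (hab : a < b) {φ : ℝ → ℂ}
    (hφ : ContDiff ℝ (⊤ : ℕ∞) φ) (hs : Function.support φ ⊆ Set.Icc a b)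
    (hint : ∫ t in a..b, φ t = 0) :
    ∃ (M : ℝ) (c : ℤ → ℂ), 0 ≤ M ∧ ∀ n : ℕ, 2 ≤ n → ∀ t ∈ Set.Ico a b,
      ‖φ t - ∑ k ∈ (freqs n).erase 0, c k * gridExp a b k t‖ ≤ M / n := by
  obtain ⟨M, hM0, hM⟩ := exists_norm_fourierCoeffOn_le_div_pow hab 3 hφ hs
  have hsum : Summable fun k : ℤ => 1 / (k : ℝ) ^ 2 :=
    Real.summable_one_div_int_pow.2 one_lt_two
  have h0 : fourierCoeffOn hab φ 0 = 0 := by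
    rw [fourierCoeffOn_eq_integral]
    simp [hint]
  refine ⟨3 * M * ∑' k : ℤ, 1 / (k : ℝ) ^ 2, fourierCoeffOn hab φ,
    mul_nonneg (by positivity) (tsum_nonneg fun k => by positivity), fun n hn t ht => ?_⟩
  have hn' : (0 : ℝ) < n := by exact_mod_cast (by omega : 0 < n)
  set F := (freqs n).erase 0 with hF
  have h1 := hasSum_fourierCoeffOn_mul_gridExp hab hφ hs ht
  have h2 : HasSum (fun k : ℤ => if k ∈ F then fourierCoeffOn hab φ k * gridExp a b k t else 0)
      (∑ k ∈ F, fourierCoeffOn hab φ k * gridExp a b k t) := by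
    rw [← Finset.sum_congr rfl fun k hk => if_pos hk]
    exact hasSum_sum_of_ne_finset_zero fun k hk => if_neg hk
  have h3 := hsum.hasSum.mul_left (3 * M / n)
  have h4 := (h1.sub h2).norm_le_of_bounded h3 ?_
  · refine h4.trans_eq ?_
    ring
  intro k
  split_ifs with hk
  · rw [sub_self, norm_zero]; positivity
  rw [sub_zero, norm_mul, norm_gridExp, mul_one]
  rcases eq_or_ne k 0 with rfl | hk0
  · rw [h0, norm_zero]; positivity
  -- One power of `|k| ≥ n / 3` gives the factor `1 / n`; the other two make the sum converge.
  have hkn : (n : ℝ) ≤ 3 * |(k : ℝ)| := by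
    rw [hF, mem_freqs_erase_iff] at hk
    have : (n : ℤ) ≤ 3 * |k| := by
      rcases abs_cases k with h | h <;> omega
    exact_mod_cast this
  have hk' : 0 < |(k : ℝ)| := abs_pos.2 (by exact_mod_cast hk0)
  refine (hM k hk0).trans ?_
  rw [← sq_abs, div_mul_div_comm, mul_one, div_le_div_iff₀ (by positivity) (by positivity)]
  have : 0 ≤ M * |(k : ℝ)| ^ 2 := by positivity
  calc M * (n * |(k : ℝ)| ^ 2) = M * |(k : ℝ)| ^ 2 * n := by ring
    _ ≤ M * |(k : ℝ)| ^ 2 * (3 * |(k : ℝ)|) := by gcongr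
    _ = _ := by ring

lemma integral_gridExp {a b : ℝ} (hab : a < b) {k : ℤ} (hk : k ≠ 0) (t : ℝ) :
    ∫ s in a..t, gridExp a b k s
      = (b - a : ℝ) / (2 * Real.pi * Complex.I * k) * (gridExp a b k t - gridExp a b k a) := by
  have hL : ((b - a : ℝ) : ℂ) ≠ 0 := by
    exact_mod_cast (sub_pos.2 hab).ne'
  have hpi : (Real.pi : ℂ) ≠ 0 := by exact_mod_cast Real.pi_ne_zero
  have hk' : (k : ℂ) ≠ 0 := by exact_mod_cast hk
  have hc : (2 * Real.pi * Complex.I * k / (b - a : ℝ) : ℂ) ≠ 0 := by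
    simp only [ne_eq, div_eq_zero_iff, mul_eq_zero, OfNat.ofNat_ne_zero, hpi, Complex.I_ne_zero,
      hk', hL, or_self, not_false_eq_true]
  have hform : ∀ s : ℝ, gridExp a b k s
      = Complex.exp ((2 * Real.pi * Complex.I * k / (b - a : ℝ) : ℂ) * s) := by
    intro s
    rw [gridExp]
    congr 1
    ring
  simp only [hform]
  rw [integral_exp_mul_complex hc]
  field_simp

lemma continuous_gridExp (a b : ℝ) (k : ℤ) : Continuous (gridExp a b k) := by
  unfold gridExp
  fun_prop

lemma gridPoint_mem_Ico {a b : ℝ} (hab : a < b) {n j : ℕ} (hj : j < n) :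
    gridPoint a b n j ∈ Set.Ico a b := by
  have hL : 0 < b - a := sub_pos.2 hab
  have hn' : (0 : ℝ) < n := by exact_mod_cast (by omega : 0 < n)
  have hj' : (j : ℝ) < n := by exact_mod_cast hj
  rw [gridPoint, Set.mem_Ico]
  constructor
  · have : 0 ≤ (j : ℝ) * (b - a) / n := by positivity
    linarith
  · have : (j : ℝ) * (b - a) / n < b - a := by
      rw [div_lt_iff₀ hn']
      nlinarith
    linarith

/-- On the grid, the discrete Volterra operator approximates the Volterra operator to order `1 / n`:
it is exact on the approximating trigonometric polynomial, and both operators are bounded in the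
uniform norm on the remainder. -/
lemma exists_norm_volterraApprox_sub_le {a b : ℝ} (hab : a < b) {h : ℝ → ℝ}
    (hh : ContDiff ℝ (⊤ : ℕ∞) h) (hs : Function.support h ⊆ Set.Icc a b)
    (hint : ∫ t in a..b, h t = 0) :
    ∃ C : ℝ, 0 ≤ C ∧ ∀ n : ℕ, 2 ≤ n → ∀ j : Fin n,
      ‖volterraApprox a b (fun l : Fin n => h (gridPoint a b n l)) (gridPoint a b n j)
        - (volterra a h (gridPoint a b n j) : ℂ)‖ ≤ C / n := by
  have hL : 0 < b - a := sub_pos.2 hab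
  have hφ : ContDiff ℝ (⊤ : ℕ∞) fun t => (h t : ℂ) := Complex.ofRealCLM.contDiff.comp hh
  have hφs : Function.support (fun t => (h t : ℂ)) ⊆ Set.Icc a b := fun t ht => hs (by simpa using ht)
  obtain ⟨M, c, hM0, hM⟩ := exists_trigPolynomial_approx hab hφ hφs (by
    rw [intervalIntegral.integral_ofReal, hint, Complex.ofReal_zero])
  refine ⟨4 * (b - a) * M, by positivity, fun n hn j => ?_⟩
  have hn' : (0 : ℝ) < n := by exact_mod_cast (by omega : 0 < n)
  set T : ℝ → ℂ := fun t => ∑ k ∈ (freqs n).erase 0, c k * gridExp a b k t with hT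
  set τ := gridPoint a b n j with hτ
  have hτm : τ ∈ Set.Ico a b := gridPoint_mem_Ico hab j.2
  have hTc : Continuous T := by
    refine continuous_finsetSum _ fun k _ => continuous_const.mul (continuous_gridExp a b k)
  have hTint : ∑ l : Fin n, T (gridPoint a b n l)
      * (volterraKernel a b n τ (gridPoint a b n l) : ℂ) = ∫ s in a..τ, T s := by
    simp only [hT, Finset.sum_mul]
    have hi : ∀ k ∈ (freqs n).erase 0,
        IntervalIntegrable (fun s => c k * gridExp a b k s) volume a τ := fun k _ =>
      (continuous_const.mul (continuous_gridExp a b k)).intervalIntegrable _ _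
    rw [Finset.sum_comm, intervalIntegral.integral_finsetSum hi]
    refine Finset.sum_congr rfl fun k hk => ?_
    rw [intervalIntegral.integral_const_mul, integral_gridExp hab (Finset.ne_of_mem_erase hk),
      ← sum_gridExp_mul_volterraKernel hab hk, Finset.mul_sum]
    exact Finset.sum_congr rfl fun l _ => by ring
  have hV : (volterra a h τ : ℂ) = ∫ s in a..τ, (h s : ℂ) := by
    rw [volterra, intervalIntegral.integral_ofReal]
  have hsplit : volterraApprox a b (fun l : Fin n => h (gridPoint a b n l)) τ
      - (volterra a h τ : ℂ)
      = ∑ l : Fin n, ((h (gridPoint a b n l) : ℂ) - T (gridPoint a b n l))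
          * (volterraKernel a b n τ (gridPoint a b n l) : ℂ)
        - ∫ s in a..τ, ((h s : ℂ) - T s) := by
    rw [volterraApprox_eq_sum_kernel hab hn, hV, intervalIntegral.integral_sub
      (hφ.continuous.intervalIntegrable _ _) (hTc.intervalIntegrable _ _), ← hTint]
    simp only [sub_mul, Finset.sum_sub_distrib]
    ring
  have hA : ‖∑ l : Fin n, ((h (gridPoint a b n l) : ℂ) - T (gridPoint a b n l))
      * (volterraKernel a b n τ (gridPoint a b n l) : ℂ)‖ ≤ 3 * (b - a) * M / n := by
    calc _ ≤ ∑ l : Fin n, M / n * (3 * (b - a) / n) := by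
          refine norm_sum_le_of_le _ fun l _ => ?_
          rw [norm_mul, Complex.norm_real]
          exact mul_le_mul (hM n hn _ (gridPoint_mem_Ico hab l.2))
            (abs_volterraKernel_le hab (by omega) _ _) (norm_nonneg _) (by positivity)
      _ = _ := by
          rw [Finset.sum_const, Finset.card_univ, Fintype.card_fin, nsmul_eq_mul]
          field_simp
  have hB : ‖∫ s in a..τ, ((h s : ℂ) - T s)‖ ≤ M / n * (b - a) := by
    calc _ ≤ M / n * |τ - a| := by
          refine intervalIntegral.norm_integral_le_of_norm_le_const fun s hs => ?_
          rw [Set.uIoc_of_le hτm.1] at hs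
          exact hM n hn s ⟨hs.1.le, hs.2.trans_lt hτm.2⟩
      _ ≤ _ := by
          rw [abs_of_nonneg (sub_nonneg.2 hτm.1)]
          have := hτm.2
          gcongr
  rw [hsplit]
  refine (norm_sub_le _ _).trans ((add_le_add hA hB).trans_eq ?_)
  ring

/-! ### Discrete norms as norms of step functions -/

/-- The `p`-norm of a vector indexed by a grid of mesh `L / n`. -/
def gridNorm (L : ℝ) (p : ℝ≥0∞) {n : ℕ} (v : Fin n → ℂ) : ℝ :=
  if p = ∞ then ⨆ j : Fin n, ‖v j‖
  else (L / n * ∑ j : Fin n, ‖v j‖ ^ p.toReal) ^ (1 / p.toReal)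

lemma discreteVolterraNorm_eq_gridNorm (a b : ℝ) (p : ℝ≥0∞) {n : ℕ} (x : Fin n → ℝ) :
    discreteVolterraNorm a b p x
      = gridNorm (b - a) p fun j : Fin n => volterraApprox a b x (gridPoint a b n j) := rfl

/-- The index `j` of the cell `[t_j, t_{j+1})` that contains `t`, for `t ∈ [a, b)`. -/
def cellIndex (a b : ℝ) (n : ℕ) [NeZero n] (t : ℝ) : Fin n :=
  Fin.ofNat n ⌊(t - a) * n / (b - a)⌋₊

lemma measurable_cellIndex (a b : ℝ) (n : ℕ) [NeZero n] : Measurable (cellIndex a b n) := by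
  unfold cellIndex
  exact (measurable_from_nat (f := fun k => Fin.ofNat n k)).comp
    (Nat.measurable_floor.comp (by fun_prop))

lemma cellIndex_eq_iff {a b : ℝ} (hab : a < b) {n : ℕ} [NeZero n] {t : ℝ} (ht : t ∈ Set.Ico a b)
    (j : Fin n) :
    cellIndex a b n t = j ↔ t ∈ Set.Ico (gridPoint a b n j) (gridPoint a b n (j + 1)) := by
  have hL : 0 < b - a := sub_pos.2 hab
  have hn : (0 : ℝ) < n := by exact_mod_cast (NeZero.pos n)
  have h0 : 0 ≤ (t - a) * n / (b - a) := by
    have := sub_nonneg.2 ht.1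
    positivity
  have hlt : ⌊(t - a) * n / (b - a)⌋₊ < n := by
    rw [Nat.floor_lt h0, div_lt_iff₀ hL]
    have := ht.2
    nlinarith
  rw [cellIndex, Fin.ext_iff, Fin.val_ofNat, Nat.mod_eq_of_lt hlt, Nat.floor_eq_iff h0,
    le_div_iff₀ hL, div_lt_iff₀ hL, gridPoint, gridPoint, Set.mem_Ico, ← le_sub_iff_add_le',
    ← sub_lt_iff_lt_add', div_le_iff₀ hn, lt_div_iff₀ hn]
  push_cast
  rfl

lemma map_cellIndex {a b : ℝ} (hab : a < b) (n : ℕ) [NeZero n] :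
    (volume.restrict (Set.Icc a b)).map (cellIndex a b n)
      = ENNReal.ofReal ((b - a) / n) • Measure.count := by
  have hL : 0 < b - a := sub_pos.2 hab
  have hn : (0 : ℝ) < n := by exact_mod_cast (NeZero.pos n)
  refine Measure.ext_of_singleton fun j => ?_
  rw [Measure.map_apply (measurable_cellIndex a b n) (measurableSet_singleton j),
    ← restrict_Ico_eq_restrict_Icc,
    Measure.restrict_apply (measurable_cellIndex a b n (measurableSet_singleton j))]
  have hset : cellIndex a b n ⁻¹' {j} ∩ Set.Ico a b
      = Set.Ico (gridPoint a b n j) (gridPoint a b n (j + 1)) := by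
    have hj1 : (0 : ℝ) ≤ j := by positivity
    have hj2 : ((j : ℕ) : ℝ) + 1 ≤ n := by exact_mod_cast j.2
    ext t
    constructor
    · rintro ⟨h1, h2⟩
      exact (cellIndex_eq_iff hab h2 j).1 h1
    · intro h
      have ht : t ∈ Set.Ico a b := by
        refine ⟨(gridPoint_mem_Ico hab j.2).1.trans h.1, h.2.trans_le ?_⟩
        rw [gridPoint, ← le_sub_iff_add_le', div_le_iff₀ hn]
        push_cast
        nlinarith
      exact ⟨(cellIndex_eq_iff hab ht j).2 h, ht⟩
  rw [hset, Real.volume_Ico, Measure.smul_apply, Measure.count_singleton, smul_eq_mul, mul_one]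
  congr 1
  rw [gridPoint, gridPoint]
  push_cast
  ring

/-- The `p`-norm of a vector on the grid is the `L^p` norm of the corresponding step function. -/
lemma toReal_eLpNorm_comp_cellIndex {a b : ℝ} (hab : a < b) {p : ℝ≥0∞} (hp : 1 ≤ p) {n : ℕ}
    [NeZero n] (v : Fin n → ℂ) :
    (eLpNorm (fun t => v (cellIndex a b n t)) p (volume.restrict (Set.Icc a b))).toReal
      = gridNorm (b - a) p v := by
  have hL : 0 < b - a := sub_pos.2 hab
  have hn : (0 : ℝ) < n := by exact_mod_cast (NeZero.pos n)
  have hw : 0 < (b - a) / n := by positivity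
  have h1 := eLpNorm_map_measure (p := p) (μ := volume.restrict (Set.Icc a b))
    (f := cellIndex a b n) (g := v)
    (Measurable.of_discrete (f := v)).aestronglyMeasurable (measurable_cellIndex a b n).aemeasurable
  change (eLpNorm (v ∘ cellIndex a b n) p _).toReal = _
  rw [← h1, map_cellIndex hab, gridNorm]
  split_ifs with hp'
  · rw [hp', eLpNorm_exponent_top, eLpNormEssSup_eq_essSup_enorm, essSup_eq_iSup,
      ENNReal.toReal_iSup fun j => enorm_ne_top]
    · simp
    · intro j
      simpa using hw
  · rw [eLpNorm_eq_lintegral_rpow_enorm_toReal (by positivity) hp', lintegral_smul_measure,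
      lintegral_count, tsum_fintype, ← ENNReal.toReal_rpow, smul_eq_mul, ENNReal.toReal_mul,
      ENNReal.toReal_ofReal hw.le, ENNReal.toReal_sum fun j _ => by
        exact ENNReal.rpow_ne_top_of_nonneg ENNReal.toReal_nonneg enorm_ne_top]
    simp [← ENNReal.toReal_rpow]

/-- The factor `L ^ (1 / p)` that compares normalized norms is at most `max 1 L`. -/
lemma rpow_le_max_one {L r : ℝ} (hL : 0 < L) (hr0 : 0 ≤ r) (hr1 : r ≤ 1) : L ^ r ≤ max 1 L := by
  calc L ^ r ≤ (max 1 L) ^ r := Real.rpow_le_rpow hL.le (le_max_right _ _) hr0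
    _ ≤ (max 1 L) ^ (1 : ℝ) := Real.rpow_le_rpow_of_exponent_le (le_max_left _ _) hr1
    _ = _ := Real.rpow_one _

lemma toReal_inv_mem_Icc {p : ℝ≥0∞} (hp : 1 ≤ p) : 0 ≤ p.toReal⁻¹ ∧ p.toReal⁻¹ ≤ 1 := by
  refine ⟨by positivity, ?_⟩
  rcases eq_or_ne p ∞ with rfl | h
  · simp
  · exact inv_le_one_of_one_le₀ (by simpa using ENNReal.toReal_mono h hp)

/-- Stability of the discrete norm: if the vector `u` is on each cell `D`-close to `F + w`, then its
norm differs from the norm of `F` by at most the norm of `w` plus a multiple of `D`. -/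
lemma abs_gridNorm_sub_le {a b : ℝ} (hab : a < b) {p : ℝ≥0∞} (hp : 1 ≤ p) {n : ℕ} (hn : 0 < n)
    {u w : Fin n → ℂ} {F : ℝ → ℝ} (hF : Continuous F) {D : ℝ}
    (hD : ∀ j : Fin n, ∀ t ∈ Set.Ico (gridPoint a b n j) (gridPoint a b n (j + 1)),
      ‖u j - w j - (F t : ℂ)‖ ≤ D) :
    |gridNorm (b - a) p u - (eLpNorm F p (volume.restrict (Set.Icc a b))).toReal|
      ≤ gridNorm (b - a) p w + max 1 (b - a) * D := by
  have hL : 0 < b - a := sub_pos.2 hab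
  have : NeZero n := ⟨hn.ne'⟩
  set μ := volume.restrict (Set.Icc a b) with hμ
  have hD0 : 0 ≤ D := (norm_nonneg _).trans (hD ⟨0, hn⟩ (gridPoint a b n 0) ⟨le_rfl, by
    have : (0 : ℝ) < n := by exact_mod_cast hn
    simp only [gridPoint]
    push_cast
    gcongr
    norm_num⟩)
  have hstep : ∀ v : Fin n → ℂ, Measurable fun t => v (cellIndex a b n t) := fun v =>
    Measurable.of_discrete.comp (measurable_cellIndex a b n)
  have hstepLp : ∀ v : Fin n → ℂ, MemLp (fun t => v (cellIndex a b n t)) p μ := by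
    intro v
    refine MemLp.of_bound (hstep v).aestronglyMeasurable (∑ j, ‖v j‖) (Eventually.of_forall ?_)
    exact fun t => Finset.single_le_sum (f := fun j => ‖v j‖) (fun j _ => norm_nonneg _)
      (Finset.mem_univ _)
  have hFc : Continuous fun t => (F t : ℂ) := Complex.continuous_ofReal.comp hF
  have hFLp : MemLp (fun t => (F t : ℂ)) p μ := by
    obtain ⟨B, hB⟩ := (isCompact_Icc (a := a) (b := b)).exists_bound_of_continuousOn hFc.continuousOn
    exact MemLp.of_bound hFc.aestronglyMeasurable B
      ((ae_restrict_iff' measurableSet_Icc).2 (Eventually.of_forall hB))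
  set U : ℝ → ℂ := fun t => u (cellIndex a b n t) with hU
  set W : ℝ → ℂ := fun t => w (cellIndex a b n t) with hW
  set G : ℝ → ℂ := fun t => (F t : ℂ) with hG
  have hR : ∀ᵐ t ∂μ, ‖(U - W - G) t‖ ≤ D := by
    rw [hμ, ← restrict_Ico_eq_restrict_Icc]
    refine (ae_restrict_iff' measurableSet_Ico).2 (Eventually.of_forall fun t ht => ?_)
    exact hD _ t ((cellIndex_eq_iff hab ht _).1 rfl)
  have hRLp : MemLp (U - W - G) p μ := ((hstepLp u).sub (hstepLp w)).sub hFLp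
  have hRn : lpNorm (U - W - G) p μ ≤ max 1 (b - a) * D := by
    rw [← toReal_eLpNorm hRLp.1]
    have h1 := eLpNorm_le_of_ae_bound (p := p) hR
    have h2 : μ Set.univ = ENNReal.ofReal (b - a) := by
      rw [hμ, Measure.restrict_apply_univ, Real.volume_Icc]
    rw [h2] at h1
    have hr := toReal_inv_mem_Icc hp
    have h3 := ENNReal.toReal_mono (ENNReal.mul_ne_top
      (ENNReal.rpow_ne_top_of_nonneg hr.1 ENNReal.ofReal_ne_top) ENNReal.ofReal_ne_top) h1
    rw [ENNReal.toReal_mul, ← ENNReal.toReal_rpow, ENNReal.toReal_ofReal hL.le,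
      ENNReal.toReal_ofReal hD0] at h3
    refine h3.trans ?_
    gcongr
    exact rpow_le_max_one hL hr.1 hr.2
  have hUn : lpNorm U p μ = gridNorm (b - a) p u := by
    rw [← toReal_eLpNorm (hstepLp u).1, hμ, toReal_eLpNorm_comp_cellIndex hab hp]
  have hWn : lpNorm W p μ = gridNorm (b - a) p w := by
    rw [← toReal_eLpNorm (hstepLp w).1, hμ, toReal_eLpNorm_comp_cellIndex hab hp]
  have hGn : lpNorm G p μ = (eLpNorm F p μ).toReal := by
    rw [← toReal_eLpNorm hFLp.1]
    congr 1
    exact eLpNorm_congr_norm_ae (Eventually.of_forall fun t => by simp [hG])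
  have h1 : lpNorm U p μ ≤ lpNorm G p μ + (lpNorm W p μ + lpNorm (U - W - G) p μ) := by
    calc lpNorm U p μ = lpNorm (G + (W + (U - W - G))) p μ := by congr 1; ring
      _ ≤ lpNorm G p μ + lpNorm (W + (U - W - G)) p μ := lpNorm_add_le hFLp hp
      _ ≤ _ := by gcongr; exact lpNorm_add_le (hstepLp w) hp
  have h2 : lpNorm G p μ ≤ lpNorm U p μ + (lpNorm W p μ + lpNorm (U - W - G) p μ) := by
    calc lpNorm G p μ = lpNorm (U - (W + (U - W - G))) p μ := by congr 1; ring
      _ ≤ lpNorm U p μ + lpNorm (W + (U - W - G)) p μ := lpNorm_sub_le (hstepLp u) hp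
      _ ≤ _ := by gcongr; exact lpNorm_add_le (hstepLp w) hp
  rw [hUn, hGn, hWn] at h1 h2
  rw [abs_le]
  constructor <;> linarith

/-! ### Discrete norms and exponential moments -/

lemma gridNorm_le_mul_of_forall_le {L : ℝ} (hL : 0 < L) {p : ℝ≥0∞} (hp : 1 ≤ p) {n : ℕ} (hn : 0 < n)
    {w : Fin n → ℂ} {S : ℝ} (hS : ∀ j, ‖w j‖ ≤ S) : gridNorm L p w ≤ max 1 L * S := by
  have hS0 : 0 ≤ S := (norm_nonneg _).trans (hS ⟨0, hn⟩)
  have hn' : (0 : ℝ) < n := by exact_mod_cast hn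
  have : Nonempty (Fin n) := ⟨⟨0, hn⟩⟩
  rw [gridNorm]
  split_ifs with h
  · exact (ciSup_le hS).trans (le_mul_of_one_le_left hS0 (le_max_left _ _))
  · have hr := toReal_inv_mem_Icc hp
    have hp0 : p.toReal ≠ 0 := (ENNReal.toReal_pos (by positivity) h).ne'
    rw [one_div]
    calc _ ≤ (L / n * ∑ j : Fin n, S ^ p.toReal) ^ p.toReal⁻¹ := by
          gcongr with j
          exact hS j
      _ = (L * S ^ p.toReal) ^ p.toReal⁻¹ := by
          rw [Finset.sum_const, Finset.card_univ, Fintype.card_fin, nsmul_eq_mul]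
          congr 1
          field_simp
      _ = L ^ p.toReal⁻¹ * S := by
          rw [Real.mul_rpow hL.le (by positivity), Real.rpow_rpow_inv hS0 hp0]
      _ ≤ _ := by gcongr; exact rpow_le_max_one hL hr.1 hr.2

lemma gridNorm_sq_le_of_le_two {L : ℝ} (hL : 0 < L) {p : ℝ≥0∞} (hp : 1 ≤ p) (hp2 : p ≤ 2) {n : ℕ}
    (hn : 0 < n) (w : Fin n → ℂ) :
    (gridNorm L p w / max 1 L) ^ 2 ≤ 1 / n * ∑ j, ‖w j‖ ^ 2 := by
  have hn' : (0 : ℝ) < n := by exact_mod_cast hn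
  have hM : 0 < max 1 L := lt_max_of_lt_left one_pos
  have h : p ≠ ∞ := (hp2.trans_lt (by simp)).ne
  have hr := toReal_inv_mem_Icc hp
  have hp0 : 0 < p.toReal := ENNReal.toReal_pos (by positivity) h
  have hp2' : p.toReal ≤ 2 := by simpa using ENNReal.toReal_mono (by simp) hp2
  have hjensen := Real.rpow_arith_mean_le_arith_mean_rpow Finset.univ (fun _ : Fin n => 1 / (n : ℝ))
    (fun j => ‖w j‖ ^ p.toReal) (fun _ _ => by positivity)
    (by rw [Finset.sum_const, Finset.card_univ, Fintype.card_fin, nsmul_eq_mul]; field_simp)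
    (fun _ _ => by positivity) (p := 2 / p.toReal) (by rwa [le_div_iff₀ hp0, one_mul])
  simp only [← Finset.mul_sum] at hjensen
  have hpow : ∀ j, (‖w j‖ ^ p.toReal) ^ (2 / p.toReal) = ‖w j‖ ^ 2 := by
    intro j
    rw [← Real.rpow_mul (norm_nonneg _), mul_div_cancel₀ _ hp0.ne']
    norm_num
  simp only [hpow] at hjensen
  refine le_trans ?_ hjensen
  set A := 1 / (n : ℝ) * ∑ j, ‖w j‖ ^ p.toReal with hA
  have hA0 : 0 ≤ A := by positivity
  have hN : gridNorm L p w = L ^ p.toReal⁻¹ * A ^ p.toReal⁻¹ := by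
    rw [gridNorm, if_neg h, one_div, ← Real.mul_rpow hL.le hA0, hA]
    congr 1
    ring
  have hle : gridNorm L p w / max 1 L ≤ A ^ p.toReal⁻¹ := by
    rw [div_le_iff₀ hM, hN, mul_comm]
    gcongr
    exact rpow_le_max_one hL hr.1 hr.2
  have h0 : 0 ≤ gridNorm L p w / max 1 L := by rw [hN]; positivity
  calc _ ≤ (A ^ p.toReal⁻¹) ^ 2 := by gcongr
    _ = _ := by
      rw [← Real.rpow_natCast, ← Real.rpow_mul hA0]
      congr 1
      push_cast
      ring

/-- Interpolation between the quadratic and the uniform norm. -/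
lemma gridNorm_le_interpolation {L : ℝ} (hL : 0 < L) {p : ℝ≥0∞} (hp2 : 2 < p) {n : ℕ}
    (hn : 0 < n) {w : Fin n → ℂ} {S : ℝ} (hS : ∀ j, ‖w j‖ ≤ S) :
    gridNorm L p w ≤ max 1 L * ((1 / n * ∑ j, ‖w j‖ ^ 2) ^ p.toReal⁻¹
      * (S ^ 2) ^ (1 / 2 - p.toReal⁻¹)) := by
  have hS0 : 0 ≤ S := (norm_nonneg _).trans (hS ⟨0, hn⟩)
  have hn' : (0 : ℝ) < n := by exact_mod_cast hn
  have hp : 1 ≤ p := le_trans (by norm_num) hp2.le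
  rcases eq_or_ne p ∞ with rfl | h
  · refine (gridNorm_le_mul_of_forall_le hL hp hn hS).trans_eq ?_
    rw [ENNReal.toReal_top, inv_zero, Real.rpow_zero, sub_zero, one_mul, ← Real.sqrt_eq_rpow,
      Real.sqrt_sq hS0]
  have hr := toReal_inv_mem_Icc hp
  have hp2' : 2 < p.toReal := by
    simpa using (ENNReal.toReal_lt_toReal (by simp) h).2 hp2
  have hp0 : 0 < p.toReal := by linarith
  set A := 1 / (n : ℝ) * ∑ j, ‖w j‖ ^ 2 with hA
  have hA0 : 0 ≤ A := by positivity
  rw [gridNorm, if_neg h, one_div]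
  have hterm : ∀ j, ‖w j‖ ^ p.toReal ≤ ‖w j‖ ^ 2 * S ^ (p.toReal - 2) := by
    intro j
    rcases (norm_nonneg (w j)).eq_or_lt with h0 | h0
    · rw [← h0, Real.zero_rpow hp0.ne']
      positivity
    · calc ‖w j‖ ^ p.toReal = ‖w j‖ ^ 2 * ‖w j‖ ^ (p.toReal - 2) := by
            rw [← Real.rpow_natCast, ← Real.rpow_add h0]
            congr 1
            push_cast
            ring
        _ ≤ _ := by
            gcongr
            exact hS j
  calc _ ≤ (L / n * ∑ j, ‖w j‖ ^ 2 * S ^ (p.toReal - 2)) ^ p.toReal⁻¹ := by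
        gcongr with j
        exact hterm j
    _ = (L * (A * S ^ (p.toReal - 2))) ^ p.toReal⁻¹ := by
        rw [← Finset.sum_mul, hA]
        congr 1
        ring
    _ = L ^ p.toReal⁻¹ * (A ^ p.toReal⁻¹ * (S ^ 2) ^ (1 / 2 - p.toReal⁻¹)) := by
        rw [Real.mul_rpow hL.le (by positivity), Real.mul_rpow hA0 (by positivity),
          ← Real.rpow_mul hS0, ← Real.rpow_natCast, ← Real.rpow_mul hS0]
        congr 3
        push_cast
        field_simp
    _ ≤ _ := by gcongr; exact rpow_le_max_one hL hr.1 hr.2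

/-- The average `(1 / n) ∑_j exp (λ ‖w j‖²)`, which controls all the discrete norms of `w`. -/
def expSqMean {n : ℕ} (l : ℝ) (w : Fin n → ℂ) : ℝ :=
  1 / n * ∑ j, Real.exp (l * ‖w j‖ ^ 2)

lemma exp_mul_mean_sq_le_expSqMean {n : ℕ} (hn : 0 < n) (l : ℝ) (w : Fin n → ℂ) :
    Real.exp (l * (1 / n * ∑ j, ‖w j‖ ^ 2)) ≤ expSqMean l w := by
  have hn' : (0 : ℝ) < n := by exact_mod_cast hn
  have h := convexOn_exp.map_sum_le (t := Finset.univ) (w := fun _ : Fin n => 1 / (n : ℝ))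
    (p := fun j => l * ‖w j‖ ^ 2) (fun _ _ => by positivity)
    (by rw [Finset.sum_const, Finset.card_univ, Fintype.card_fin, nsmul_eq_mul]; field_simp)
    (fun _ _ => Set.mem_univ _)
  simp only [smul_eq_mul, ← Finset.mul_sum] at h
  rw [expSqMean]
  refine le_trans (le_of_eq ?_) h
  ring_nf

lemma exp_mul_norm_sq_le_mul_expSqMean {n : ℕ} (hn : 0 < n) (l : ℝ) (w : Fin n → ℂ) (j : Fin n) :
    Real.exp (l * ‖w j‖ ^ 2) ≤ n * expSqMean l w := by
  have hn' : (0 : ℝ) < n := by exact_mod_cast hn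
  rw [expSqMean, ← mul_assoc, mul_one_div_cancel hn'.ne', one_mul]
  exact Finset.single_le_sum (f := fun j => Real.exp (l * ‖w j‖ ^ 2))
    (fun j _ => (Real.exp_pos _).le) (Finset.mem_univ j)

lemma gridNorm_nonneg {L : ℝ} (hL : 0 < L) (p : ℝ≥0∞) {n : ℕ} (w : Fin n → ℂ) :
    0 ≤ gridNorm L p w := by
  rw [gridNorm]
  split_ifs
  · exact Real.iSup_nonneg fun j => norm_nonneg _
  · positivity

lemma exp_gridNorm_sq_le_of_le_two {L l : ℝ} (hL : 0 < L) (hl : 0 ≤ l) {p : ℝ≥0∞} (hp : 1 ≤ p)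
    (hp2 : p ≤ 2) {n : ℕ} (hn : 0 < n) (w : Fin n → ℂ) :
    Real.exp (l * (gridNorm L p w / max 1 L) ^ 2) ≤ expSqMean l w := by
  refine le_trans ?_ (exp_mul_mean_sq_le_expSqMean hn l w)
  gcongr
  exact gridNorm_sq_le_of_le_two hL hp hp2 hn w

lemma exp_gridNorm_sq_le {L l : ℝ} (hL : 0 < L) (hl : 0 ≤ l) {p : ℝ≥0∞} (hp : 1 ≤ p)
    {n : ℕ} (hn : 0 < n) (w : Fin n → ℂ) :
    Real.exp (l * (gridNorm L p w / max 1 L) ^ 2) ≤ n * expSqMean l w := by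
  have hM : 0 < max 1 L := lt_max_of_lt_left one_pos
  have : Nonempty (Fin n) := ⟨⟨0, hn⟩⟩
  obtain ⟨j, hj⟩ := Finite.exists_max fun j => ‖w j‖
  refine le_trans ?_ (exp_mul_norm_sq_le_mul_expSqMean hn l w j)
  have h1 := gridNorm_le_mul_of_forall_le hL hp hn hj
  have h0 := gridNorm_nonneg hL p w
  gcongr
  rwa [div_le_iff₀ hM, mul_comm]

/-- The bound behind the expected error: `‖w‖_p` is at most
`max(1, L) λ^{-1/2} (log n)^{m(p)}` up to a factor `1 + 2 Q`, where `Q` is the exponential mean.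
For `p > 2` the mean square of `w` is bounded by `λ⁻¹ Q` and the squared uniform norm by
`λ⁻¹ log (n Q)`, and the two are interpolated. -/
lemma gridNorm_le_mul_expSqMean {L l : ℝ} (hL : 0 < L) (hl : 0 < l) {p : ℝ≥0∞} (hp : 1 ≤ p)
    {n : ℕ} (hn : 2 ≤ n) (w : Fin n → ℂ) :
    gridNorm L p w
      ≤ max 1 L * (1 / √l) * Real.log n ^ logExponent p * (1 + 2 * expSqMean l w) := by
  have hn0 : 0 < n := by omega
  have hn' : (0 : ℝ) < n := by exact_mod_cast hn0
  have hM : 0 < max 1 L := lt_max_of_lt_left one_pos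
  have hsl : 0 < √l := Real.sqrt_pos.2 hl
  set Q := expSqMean l w with hQ
  have hq2 := exp_mul_mean_sq_le_expSqMean hn0 l w
  rw [← hQ] at hq2
  have hQpos : 0 < Q := (Real.exp_pos _).trans_le hq2
  set A := 1 / (n : ℝ) * ∑ j, ‖w j‖ ^ 2 with hA
  have hA0 : 0 ≤ A := by positivity
  have hAQ : l * A ≤ Q := by linarith [Real.add_one_le_exp (l * A)]
  have hlA : A ≤ l⁻¹ * (1 + 2 * Q) := by
    rw [inv_mul_eq_div, le_div_iff₀ hl]; linarith
  have hroot : √(1 + 2 * Q) ≤ 1 + 2 * Q := by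
    rw [Real.sqrt_le_left (by positivity)]
    nlinarith
  have hfac : (1 / p).toReal = p.toReal⁻¹ := by rw [one_div, ENNReal.toReal_inv]
  rcases le_or_gt p 2 with hp2 | hp2
  · have hp2' : p.toReal ≤ 2 := by simpa using ENNReal.toReal_mono (by simp) hp2
    have hp0 : 0 < p.toReal :=
      ENNReal.toReal_pos (by positivity) (hp2.trans_lt (by simp)).ne
    have hm : logExponent p = 0 := by
      rw [logExponent, hfac, max_eq_right]
      rw [sub_nonpos, one_div]
      exact inv_anti₀ hp0 hp2'
    rw [hm, Real.rpow_zero, mul_one]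
    have h1 := (gridNorm_sq_le_of_le_two hL hp hp2 hn0 w).trans hlA
    have h2 := Real.le_sqrt_of_sq_le h1
    rw [Real.sqrt_mul (by positivity), Real.sqrt_inv, div_le_iff₀ hM] at h2
    calc _ ≤ (√l)⁻¹ * √(1 + 2 * Q) * max 1 L := h2
      _ ≤ (√l)⁻¹ * (1 + 2 * Q) * max 1 L := by gcongr
      _ = _ := by rw [one_div]; ring
  · have : Nonempty (Fin n) := ⟨⟨0, hn0⟩⟩
    obtain ⟨i, hi⟩ := Finite.exists_max fun j => ‖w j‖
    have hlogn : 1 / 2 ≤ Real.log n := by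
      have h1 : Real.log 2 ≤ Real.log n := Real.log_le_log (by norm_num) (by exact_mod_cast hn)
      linarith [Real.log_two_gt_d9]
    have hSlog : l * ‖w i‖ ^ 2 ≤ Real.log n * (1 + 2 * Q) := by
      have h1 := (Real.le_log_iff_exp_le (by positivity)).2
        (exp_mul_norm_sq_le_mul_expSqMean hn0 l w i)
      rw [Real.log_mul hn'.ne' hQpos.ne'] at h1
      have h2 := Real.log_le_self hQpos.le
      nlinarith
    have hS2 : ‖w i‖ ^ 2 ≤ l⁻¹ * (1 + 2 * Q) * Real.log n := by
      rw [mul_assoc, inv_mul_eq_div, le_div_iff₀ hl]; linarith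
    have hr0 : 0 ≤ p.toReal⁻¹ := by positivity
    have hr2 : 0 ≤ 1 / 2 - p.toReal⁻¹ := by
      rcases eq_or_ne p ∞ with rfl | h
      · simp
      · have hp2' : 2 < p.toReal := by
          simpa using (ENNReal.toReal_lt_toReal (by simp) h).2 hp2
        rw [sub_nonneg, one_div]
        exact inv_anti₀ (by norm_num) hp2'.le
    have hm : logExponent p = 1 / 2 - p.toReal⁻¹ := by
      rw [logExponent, hfac, max_eq_left hr2]
    refine (gridNorm_le_interpolation hL hp2 hn0 hi).trans ?_
    rw [hm]
    set r := p.toReal⁻¹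
    set R := l⁻¹ * (1 + 2 * Q) with hR
    have hR0 : 0 < R := by positivity
    calc _ ≤ max 1 L * (R ^ r * (R * Real.log n) ^ (1 / 2 - r)) := by gcongr
      _ = max 1 L * (R ^ (1 / 2 : ℝ) * Real.log n ^ (1 / 2 - r)) := by
          rw [Real.mul_rpow hR0.le (by linarith), ← mul_assoc (R ^ r), ← Real.rpow_add hR0]
          congr 3
          ring
      _ = max 1 L * (1 / √l) * Real.log n ^ (1 / 2 - r) * √(1 + 2 * Q) := by
          rw [← Real.sqrt_eq_rpow, hR, Real.sqrt_mul (by positivity), Real.sqrt_inv]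
          ring
      _ ≤ _ := by gcongr

/-! ### Exponential moments of the noise -/

/-- If `l v ≤ 1 / 4`, then multiplying the density of variance `v` by `exp (l x²)` gives at most
twice the density of variance `2 v`, hence the bound on the integral. -/
lemma integrable_exp_mul_sq_gaussianReal {l : ℝ} {v : ℝ≥0} (hlv : l * v ≤ 1 / 4) :
    Integrable (fun x => Real.exp (l * x ^ 2)) (gaussianReal 0 v) ∧
      ∫ x, Real.exp (l * x ^ 2) ∂(gaussianReal 0 v) ≤ 2 := by
  rcases eq_or_ne v 0 with rfl | hv
  · rw [gaussianReal_zero_var]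
    refine ⟨integrable_dirac (by simp), ?_⟩
    rw [integral_dirac]
    norm_num
  have hv' : (0 : ℝ) < v := by exact_mod_cast pos_iff_ne_zero.2 hv
  have hbound : ∀ x, gaussianPDFReal 0 v x * Real.exp (l * x ^ 2)
      ≤ 2 * gaussianPDFReal 0 (2 * v) x := by
    intro x
    rw [gaussianPDFReal, gaussianPDFReal, mul_assoc, ← Real.exp_add]
    push_cast
    have hsqrt : (√(2 * Real.pi * v))⁻¹ ≤ 2 * (√(2 * Real.pi * (2 * v)))⁻¹ := by
      have h1 : √(2 * Real.pi * (2 * v)) ≤ 2 * √(2 * Real.pi * v) := by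
        rw [Real.sqrt_le_left (by positivity), mul_pow, Real.sq_sqrt (by positivity)]
        have : 0 < Real.pi * v := by positivity
        nlinarith
      have h2 : 0 < √(2 * Real.pi * v) := by positivity
      have h3 : 0 < √(2 * Real.pi * (2 * v)) := by positivity
      rw [inv_eq_one_div, inv_eq_one_div, mul_one_div, div_le_div_iff₀ h2 h3]
      linarith
    have hexp : -(x - 0) ^ 2 / (2 * v) + l * x ^ 2 ≤ -(x - 0) ^ 2 / (2 * (2 * v)) := by
      rw [sub_zero, ← sub_nonneg]
      have : -x ^ 2 / (2 * (2 * v)) - (-x ^ 2 / (2 * v) + l * x ^ 2)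
          = x ^ 2 * (1 / 4 - l * v) / v := by
        field_simp
        ring
      rw [this]
      have := sub_nonneg.2 hlv
      positivity
    rw [← mul_assoc]
    exact mul_le_mul hsqrt (Real.exp_le_exp.2 hexp) (Real.exp_pos _).le (by positivity)
  have hdom : Integrable fun x => 2 * gaussianPDFReal 0 (2 * v) x :=
    (integrable_gaussianPDFReal 0 (2 * v)).const_mul 2
  have hint : Integrable fun x => gaussianPDFReal 0 v x * Real.exp (l * x ^ 2) := by
    refine hdom.mono' (by fun_prop) (Eventually.of_forall fun x => ?_)
    rw [Real.norm_of_nonneg (mul_nonneg (gaussianPDFReal_nonneg _ _ _) (Real.exp_pos _).le)]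
    exact hbound x
  constructor
  · rw [gaussianReal_of_var_ne_zero _ hv,
      integrable_withDensity_iff_integrable_smul' (measurable_gaussianPDF _ _)
        (ae_of_all _ fun _ => gaussianPDF_lt_top)]
    simpa only [toReal_gaussianPDF, smul_eq_mul] using hint
  · rw [integral_gaussianReal_eq_integral_smul hv]
    simp only [smul_eq_mul]
    refine (integral_mono hint hdom hbound).trans_eq ?_
    rw [integral_const_mul, integral_gaussianPDFReal_eq_one 0 (by simpa using hv), mul_one]

lemma hasLaw_sum_mul_gaussianReal {Ω ι : Type*} [MeasurableSpace Ω] {P : Measure Ω}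
    [IsProbabilityMeasure P] {X : ι → Ω → ℝ} {v : ι → ℝ≥0}
    (hX : ∀ i, HasLaw (X i) (gaussianReal 0 (v i)) P)
    (hind : iIndepFun X P) (c : ι → ℝ) (s : Finset ι) :
    HasLaw (∑ i ∈ s, fun ω => c i * X i ω)
      (gaussianReal 0 (∑ i ∈ s, .mk (c i ^ 2) (sq_nonneg _) * v i)) P := by
  classical
  have hcX : ∀ i, HasLaw (fun ω => c i * X i ω)
      (gaussianReal 0 (.mk (c i ^ 2) (sq_nonneg _) * v i)) P := fun i => by
    simpa using gaussianReal_const_mul (hX i) (c i)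
  have hcind : iIndepFun (fun i ω => c i * X i ω) P :=
    hind.comp (fun i x => c i * x) fun i => measurable_const_mul (c i)
  induction s using Finset.induction_on with
  | empty =>
    simp only [Finset.sum_empty, gaussianReal_zero_var]
    exact hasLaw_dirac_of_ae_eq (Eventually.of_forall fun _ => rfl)
  | insert i s hi ih =>
    rw [Finset.sum_insert hi, Finset.sum_insert hi]
    have h := gaussianReal_add_gaussianReal_of_indepFun
      (hcind.indepFun_finsetSum_of_notMem₀ (fun i => (hcX i).aemeasurable) hi).symm
      (hcX i).map_eq ih.map_eq
    rw [add_zero] at h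
    exact ⟨(hcX i).aemeasurable.add ih.aemeasurable, h⟩

/-- The vector of the noise differences `Z[j] - Z'[j]`, `0 ≤ j < n`. -/
def noiseDiff {Ω : Type*} (Z Z' : ℕ → Ω → ℝ) (n : ℕ) (ω : Ω) : Fin n → ℝ :=
  fun j => Z j ω - Z' j ω

/-- The discrete Volterra transform of the noise on the grid. -/
def noiseTransform {Ω : Type*} (a b : ℝ) (Z Z' : ℕ → Ω → ℝ) (n : ℕ) (ω : Ω) : Fin n → ℂ :=
  fun j => volterraApprox a b (noiseDiff Z Z' n ω) (gridPoint a b n j)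

lemma noiseTransform_eq_sum {Ω : Type*} {a b : ℝ} (hab : a < b) (Z Z' : ℕ → Ω → ℝ) {n : ℕ}
    (hn : 2 ≤ n) (ω : Ω) (j : Fin n) :
    noiseTransform a b Z Z' n ω j
      = ((∑ l ∈ Finset.range n, (Z l ω - Z' l ω)
          * volterraKernel a b n (gridPoint a b n j) (gridPoint a b n l) : ℝ) : ℂ) := by
  rw [noiseTransform, volterraApprox_eq_sum_kernel hab hn, Finset.sum_range, Complex.ofReal_sum]
  simp [noiseDiff]

/-- Each value of the transformed noise is a centered Gaussian of variance at most `9 L² σ² / n`,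
by independence and the bound `3 L / n` on the kernel. -/
lemma exists_hasLaw_noiseTransform {Ω : Type u} [MeasurableSpace Ω] {P : Measure Ω}
    [IsProbabilityMeasure P] {a b : ℝ} (hab : a < b) {Z Z' : ℕ → Ω → ℝ} {s s' : ℕ → ℝ≥0} {σ : ℝ}
    (hZ : IsHeteroscedasticNoise P Z Z' s s' σ) {n : ℕ} (hn : 2 ≤ n) (hne : Even n) (τ : ℝ) :
    ∃ V : ℝ≥0, (V : ℝ) ≤ 9 * (b - a) ^ 2 * σ ^ 2 / n ∧
      HasLaw (fun ω => ∑ l ∈ Finset.range n, (Z l ω - Z' l ω)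
        * volterraKernel a b n τ (gridPoint a b n l)) (gaussianReal 0 V) P := by
  have hL : 0 < b - a := sub_pos.2 hab
  have hn' : (0 : ℝ) < n := by exact_mod_cast (by omega : 0 < n)
  set K : ℕ → ℝ := fun l => volterraKernel a b n τ (gridPoint a b n l) with hK
  have hKsq : ∀ l, K l ^ 2 ≤ 9 * (b - a) ^ 2 / n ^ 2 := by
    intro l
    calc K l ^ 2 = |K l| ^ 2 := (sq_abs _).symm
      _ ≤ (3 * (b - a) / n) ^ 2 := by
        gcongr
        exact abs_volterraKernel_le hab (by omega) _ _
      _ = _ := by ring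
  have hlaw := hasLaw_sum_mul_gaussianReal (P := P) (X := Sum.elim Z Z')
    (v := Sum.elim (fun j => s j ^ 2) (fun j => s' j ^ 2))
    (by rintro (j | j); exacts [hZ.law j, hZ.law' j]) hZ.indep (Sum.elim K fun l => -K l)
    ((Finset.range n).disjSum (Finset.range n))
  refine ⟨_, ?_, hlaw.congr (Eventually.of_forall fun ω => ?_)⟩
  · rw [Finset.sum_disjSum]
    push_cast
    simp only [Sum.elim_inl, Sum.elim_inr, neg_sq, NNReal.coe_pow]
    have havg := hZ.average_le n hn hne
    rw [← mul_add, one_div, inv_mul_le_iff₀ hn'] at havg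
    calc _ ≤ ∑ l ∈ Finset.range n, 9 * (b - a) ^ 2 / n ^ 2 * (s l : ℝ) ^ 2
          + ∑ l ∈ Finset.range n, 9 * (b - a) ^ 2 / n ^ 2 * (s' l : ℝ) ^ 2 := by
          gcongr with l _ l _
          · exact hKsq l
          · exact hKsq l
      _ = 9 * (b - a) ^ 2 / n ^ 2 * (∑ l ∈ Finset.range n, (s l : ℝ) ^ 2
          + ∑ l ∈ Finset.range n, (s' l : ℝ) ^ 2) := by
          rw [← Finset.mul_sum, ← Finset.mul_sum, mul_add]
      _ ≤ 9 * (b - a) ^ 2 / n ^ 2 * (n * σ ^ 2) := by gcongr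
      _ = _ := by field_simp
  · rw [Finset.sum_disjSum, Pi.add_apply, Finset.sum_apply, Finset.sum_apply,
      ← Finset.sum_add_distrib]
    refine Finset.sum_congr rfl fun l _ => ?_
    simp only [Sum.elim_inl, Sum.elim_inr]
    ring

/-- The exponential scale `λ = n / (36 L² σ²)` of the transformed noise: the product of `λ` and the
variance bound `9 L² σ² / n` is `1 / 4`. -/
def noiseScale (a b σ : ℝ) (n : ℕ) : ℝ := n / (36 * (b - a) ^ 2 * σ ^ 2)

lemma noiseScale_pos {a b σ : ℝ} (hab : a < b) (hσ : 0 < σ) {n : ℕ} (hn : 0 < n) :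
    0 < noiseScale a b σ n := by
  have hL : 0 < b - a := sub_pos.2 hab
  have hn' : (0 : ℝ) < n := by exact_mod_cast hn
  unfold noiseScale
  positivity

lemma integrable_expSqMean_noiseTransform {Ω : Type u} [MeasurableSpace Ω] {P : Measure Ω}
    [IsProbabilityMeasure P] {a b : ℝ} (hab : a < b) {Z Z' : ℕ → Ω → ℝ} {s s' : ℕ → ℝ≥0} {σ : ℝ}
    (hσ : 0 < σ) (hZ : IsHeteroscedasticNoise P Z Z' s s' σ) {n : ℕ} (hn : 2 ≤ n) (hne : Even n) :
    Integrable (fun ω => expSqMean (noiseScale a b σ n) (noiseTransform a b Z Z' n ω)) P ∧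
      ∫ ω, expSqMean (noiseScale a b σ n) (noiseTransform a b Z Z' n ω) ∂P ≤ 2 := by
  have hL : 0 < b - a := sub_pos.2 hab
  have hn' : (0 : ℝ) < n := by exact_mod_cast (by omega : 0 < n)
  set l := noiseScale a b σ n with hl
  have hl0 : 0 < l := noiseScale_pos hab hσ (by omega)
  have hj : ∀ j : Fin n,
      Integrable (fun ω => Real.exp (l * ‖noiseTransform a b Z Z' n ω j‖ ^ 2)) P ∧
      ∫ ω, Real.exp (l * ‖noiseTransform a b Z Z' n ω j‖ ^ 2) ∂P ≤ 2 := by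
    intro j
    obtain ⟨V, hV, hlaw⟩ := exists_hasLaw_noiseTransform hab hZ hn hne (gridPoint a b n j)
    have hlV : l * V ≤ 1 / 4 := by
      calc l * V ≤ l * (9 * (b - a) ^ 2 * σ ^ 2 / n) := by gcongr
        _ = 1 / 4 := by
          rw [hl, noiseScale]
          field_simp
          norm_num
    obtain ⟨h1, h2⟩ := integrable_exp_mul_sq_gaussianReal hlV
    have hcont : Continuous fun x : ℝ => Real.exp (l * x ^ 2) := by fun_prop
    simp only [noiseTransform_eq_sum hab Z Z' hn, Complex.norm_real, Real.norm_eq_abs, sq_abs]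
    constructor
    · rw [← hlaw.map_eq] at h1
      exact (integrable_map_measure hcont.aestronglyMeasurable hlaw.aemeasurable).1 h1
    · have h3 := hlaw.integral_comp hcont.aestronglyMeasurable
      exact h3.trans_le h2
  simp only [expSqMean]
  refine ⟨(integrable_finsetSum _ fun j _ => (hj j).1).const_mul _, ?_⟩
  rw [integral_const_mul, integral_finsetSum _ fun j _ => (hj j).1]
  calc _ ≤ 1 / (n : ℝ) * ∑ _j : Fin n, (2 : ℝ) := by
        gcongr with j
        exact (hj j).2
    _ = 2 := by
        rw [Finset.sum_const, Finset.card_univ, Fintype.card_fin, nsmul_eq_mul]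
        field_simp

lemma IsHeteroscedasticNoise.mono {Ω : Type u} [MeasurableSpace Ω] {P : Measure Ω}
    {Z Z' : ℕ → Ω → ℝ} {s s' : ℕ → ℝ≥0} {σ σ' : ℝ} (hZ : IsHeteroscedasticNoise P Z Z' s s' σ)
    (hσ : 0 ≤ σ) (h : σ ≤ σ') : IsHeteroscedasticNoise P Z Z' s s' σ' where
  law := hZ.law
  law' := hZ.law'
  indep := hZ.indep
  average_le n hn hne := (hZ.average_le n hn hne).trans (by gcongr)

/-! ### Reduction of the error to the noise -/

lemma volterraApprox_add {a b : ℝ} (hab : a < b) {n : ℕ} (hn : 2 ≤ n) (x y : Fin n → ℝ) (t : ℝ) :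
    volterraApprox a b (x + y) t = volterraApprox a b x t + volterraApprox a b y t := by
  simp only [volterraApprox_eq_sum_kernel hab hn, Pi.add_apply, Complex.ofReal_add, add_mul,
    Finset.sum_add_distrib]

/-- Pathwise, the error is at most the discrete norm of the transformed noise plus the
deterministic discretization error. -/
lemma exists_cramerError_le {a b : ℝ} (hab : a < b) {f g : ℝ → ℝ}
    (hf : ContDiff ℝ (⊤ : ℕ∞) f) (hg : ContDiff ℝ (⊤ : ℕ∞) g)
    (hf_supp : Function.support f ⊆ Set.Icc a b) (hg_supp : Function.support g ⊆ Set.Icc a b)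
    (hfg : ∫ t in a..b, f t = ∫ t in a..b, g t) :
    ∃ B : ℝ, 0 < B ∧ ∀ (Ω : Type u) (Z Z' : ℕ → Ω → ℝ) (n : ℕ), 2 ≤ n →
      ∀ p : ℝ≥0∞, 1 ≤ p → ∀ ω : Ω,
      cramerError a b f g Z Z' p n ω
        ≤ gridNorm (b - a) p (noiseTransform a b Z Z' n ω) + B / n := by
  have hL : 0 < b - a := sub_pos.2 hab
  set h : ℝ → ℝ := fun t => f t - g t with hh
  have hhc : ContDiff ℝ (⊤ : ℕ∞) h := hf.sub hg
  have hhs : Function.support h ⊆ Set.Icc a b := by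
    intro t ht
    by_contra hn
    have h1 : f t = 0 := by_contra fun h1 => hn (hf_supp h1)
    have h2 : g t = 0 := by_contra fun h2 => hn (hg_supp h2)
    exact ht (by simp [hh, h1, h2])
  have hhint : ∫ t in a..b, h t = 0 := by
    rw [hh, intervalIntegral.integral_sub (hf.continuous.intervalIntegrable _ _)
      (hg.continuous.intervalIntegrable _ _), hfg, sub_self]
  obtain ⟨C, hC0, hC⟩ := exists_norm_volterraApprox_sub_le hab hhc hhs hhint
  obtain ⟨H, hH⟩ := (isCompact_Icc (a := a) (b := b)).exists_bound_of_continuousOn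
    hhc.continuous.continuousOn
  have hH0 : 0 ≤ H := (norm_nonneg _).trans (hH a ⟨le_rfl, hab.le⟩)
  have hFc : Continuous (volterra a h) :=
    intervalIntegral.continuous_primitive (fun _ _ => hhc.continuous.intervalIntegrable _ _) a
  have hM : 0 < max 1 (b - a) := lt_max_of_lt_left one_pos
  refine ⟨max 1 (b - a) * (C + H * (b - a)) + 1, by positivity, fun Ω Z Z' n hn p hp ω => ?_⟩
  have hn' : (0 : ℝ) < n := by exact_mod_cast (by omega : 0 < n)
  have hXY : noisySamples a b f Z n ω - noisySamples a b g Z' n ω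
      = (fun l : Fin n => h (gridPoint a b n l)) + noiseDiff Z Z' n ω := by
    funext l
    simp only [noisySamples, noiseDiff, hh, Pi.sub_apply, Pi.add_apply]
    ring
  rw [cramerError, discreteCramerDist, hXY, discreteVolterraNorm_eq_gridNorm, cramerDist,
    volterraNorm]
  have key := abs_gridNorm_sub_le hab hp (n := n) (by omega)
    (u := fun j : Fin n => volterraApprox a b
      ((fun l : Fin n => h (gridPoint a b n l)) + noiseDiff Z Z' n ω) (gridPoint a b n j))
    (w := noiseTransform a b Z Z' n ω) hFc (D := (C + H * (b - a)) / n) ?_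
  · refine key.trans ?_
    gcongr
    rw [mul_div_assoc']
    gcongr
    linarith
  intro j t ht
  have hsub : volterraApprox a b
      ((fun l : Fin n => h (gridPoint a b n l)) + noiseDiff Z Z' n ω) (gridPoint a b n j)
      - noiseTransform a b Z Z' n ω j
      = volterraApprox a b (fun l : Fin n => h (gridPoint a b n l)) (gridPoint a b n j) := by
    rw [volterraApprox_add hab hn, noiseTransform, add_sub_cancel_right]
  set τ := gridPoint a b n j with hτ
  have hτ1 : gridPoint a b n (j + 1) - τ = (b - a) / n := by
    rw [hτ, gridPoint, gridPoint]
    push_cast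
    ring
  have hτb : gridPoint a b n (j + 1) ≤ b := by
    have hj : ((j : ℕ) : ℝ) + 1 ≤ n := by exact_mod_cast j.2
    rw [gridPoint, ← le_sub_iff_add_le', div_le_iff₀ hn']
    push_cast
    nlinarith
  have hτa : a ≤ τ := (gridPoint_mem_Ico hab j.2).1
  have hlip : |volterra a h τ - volterra a h t| ≤ H * (b - a) / n := by
    rw [volterra, volterra, intervalIntegral.integral_interval_sub_left
      (hhc.continuous.intervalIntegrable _ _) (hhc.continuous.intervalIntegrable _ _)]
    calc _ ≤ H * |τ - t| := by
          refine intervalIntegral.norm_integral_le_of_norm_le_const fun x hx => hH x ?_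
          rw [Set.uIoc_comm, Set.uIoc_of_le ht.1] at hx
          exact ⟨hτa.trans hx.1.le, hx.2.trans (ht.2.le.trans hτb)⟩
      _ ≤ H * ((b - a) / n) := by
          gcongr
          rw [abs_sub_comm, abs_of_nonneg (sub_nonneg.2 ht.1)]
          linarith [ht.2]
      _ = _ := by ring
  rw [hsub]
  have hsplit : volterraApprox a b (fun l : Fin n => h (gridPoint a b n l)) τ
      - (volterra a h t : ℂ)
      = (volterraApprox a b (fun l : Fin n => h (gridPoint a b n l)) τ - (volterra a h τ : ℂ))
        + ((volterra a h τ - volterra a h t : ℝ) : ℂ) := by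
    push_cast
    ring
  rw [hsplit, add_div]
  refine (norm_add_le _ _).trans (add_le_add (hC n hn j) ?_)
  rwa [Complex.norm_real, Real.norm_eq_abs]

lemma aemeasurable_cramerError {Ω : Type u} [MeasurableSpace Ω] {P : Measure Ω} {a b : ℝ}
    (hab : a < b) (f g : ℝ → ℝ) {Z Z' : ℕ → Ω → ℝ} (hZ : ∀ j, AEMeasurable (Z j) P)
    (hZ' : ∀ j, AEMeasurable (Z' j) P) (p : ℝ≥0∞) {n : ℕ} (hn : 2 ≤ n) :
    AEMeasurable (cramerError a b f g Z Z' p n) P := by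
  have hu : ∀ j : Fin n, AEMeasurable (fun ω => ‖volterraApprox a b
      (noisySamples a b f Z n ω - noisySamples a b g Z' n ω) (gridPoint a b n j)‖) P := by
    intro j
    simp only [volterraApprox_eq_sum_kernel hab hn, Pi.sub_apply, noisySamples]
    refine AEMeasurable.norm (Finset.aemeasurable_fun_sum _ fun l _ => ?_)
    have h1 := hZ l
    have h2 := hZ' l
    fun_prop
  unfold cramerError discreteCramerDist
  simp only [discreteVolterraNorm_eq_gridNorm, gridNorm]
  have habs : ∀ {X : Ω → ℝ}, AEMeasurable X P → ∀ c : ℝ, AEMeasurable (fun ω => |X ω - c|) P :=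
    fun hX c => continuous_abs.measurable.comp_aemeasurable (hX.sub_const c)
  split_ifs
  · exact habs (AEMeasurable.iSup hu) _
  · refine habs (((Finset.aemeasurable_fun_sum _ fun j _ => ?_).const_mul _).pow_const _) _
    exact (hu j).pow_const _

/-! ### The probabilistic estimates -/

/-- Markov's inequality for the exponential mean of the transformed noise. -/
lemma measureReal_le_cramerError_le {Ω : Type u} [MeasurableSpace Ω] {P : Measure Ω}
    [IsProbabilityMeasure P] {a b : ℝ} (hab : a < b) {f g : ℝ → ℝ} {Z Z' : ℕ → Ω → ℝ}
    {s s' : ℕ → ℝ≥0} {σ : ℝ} (hσ : 0 < σ) (hZ : IsHeteroscedasticNoise P Z Z' s s' σ) {n : ℕ}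
    (hn : 2 ≤ n) (hne : Even n) {p : ℝ≥0∞} {B t κ : ℝ} (ht : 0 ≤ t) (hBt : 2 * B ≤ n * t)
    (hB : ∀ ω, cramerError a b f g Z Z' p n ω
      ≤ gridNorm (b - a) p (noiseTransform a b Z Z' n ω) + B / n)
    (hκ : ∀ ω, Real.exp (noiseScale a b σ n
      * (gridNorm (b - a) p (noiseTransform a b Z Z' n ω) / max 1 (b - a)) ^ 2)
        ≤ κ * expSqMean (noiseScale a b σ n) (noiseTransform a b Z Z' n ω)) (hκ0 : 0 ≤ κ) :
    P.real {ω | t ≤ cramerError a b f g Z Z' p n ω}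
      ≤ 2 * κ * Real.exp (-(1 / (144 * (b - a) ^ 2 * max 1 (b - a) ^ 2)
          * (n * t ^ 2 / σ ^ 2))) := by
  have hL : 0 < b - a := sub_pos.2 hab
  have hn' : (0 : ℝ) < n := by exact_mod_cast (by omega : 0 < n)
  have hM : 0 < max 1 (b - a) := lt_max_of_lt_left one_pos
  have hl0 : 0 < noiseScale a b σ n := noiseScale_pos hab hσ (by omega)
  obtain ⟨hint, hle⟩ := integrable_expSqMean_noiseTransform hab hσ hZ hn hne
  set E := Real.exp (noiseScale a b σ n * (t / 2 / max 1 (b - a)) ^ 2) with hE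
  have hE0 : 0 < E := Real.exp_pos _
  have hEeq : Real.exp (-(1 / (144 * (b - a) ^ 2 * max 1 (b - a) ^ 2) * (n * t ^ 2 / σ ^ 2)))
      = E⁻¹ := by
    rw [hE, ← Real.exp_neg, noiseScale]
    congr 2
    field_simp
    ring
  have hsub : {ω | t ≤ cramerError a b f g Z Z' p n ω} ⊆ {ω | E ≤ κ
      * expSqMean (noiseScale a b σ n) (noiseTransform a b Z Z' n ω)} := by
    intro ω hω
    refine le_trans ?_ (hκ ω)
    have h1 : B / n ≤ t / 2 := by
      rw [div_le_iff₀ hn']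
      linarith
    have h2 : t / 2 ≤ gridNorm (b - a) p (noiseTransform a b Z Z' n ω) := by
      have h3 := hB ω
      have h4 : t ≤ cramerError a b f g Z Z' p n ω := hω
      linarith
    rw [hE]
    gcongr
  have hmarkov := mul_meas_ge_le_integral_of_nonneg (μ := P) (Eventually.of_forall fun ω =>
    mul_nonneg hκ0 (by unfold expSqMean; positivity)) (hint.const_mul κ) E
  rw [integral_const_mul] at hmarkov
  have h1 := measureReal_mono (μ := P) hsub
  rw [hEeq, ← div_eq_mul_inv, le_div_iff₀ hE0]
  calc _ ≤ E * P.real {ω | E ≤ κ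
        * expSqMean (noiseScale a b σ n) (noiseTransform a b Z Z' n ω)} := by
        rw [mul_comm]; gcongr
    _ ≤ κ * 2 := hmarkov.trans (by gcongr)
    _ = _ := by ring

lemma integral_cramerError_le {Ω : Type u} [MeasurableSpace Ω] {P : Measure Ω}
    [IsProbabilityMeasure P] {a b : ℝ} (hab : a < b) {f g : ℝ → ℝ} {Z Z' : ℕ → Ω → ℝ}
    {s s' : ℕ → ℝ≥0} {σ : ℝ} (hσ : 0 < σ) (hZ : IsHeteroscedasticNoise P Z Z' s s' σ) {n : ℕ}
    (hn : 2 ≤ n) (hne : Even n) {p : ℝ≥0∞} (hp : 1 ≤ p) {B : ℝ}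
    (hB : ∀ ω, cramerError a b f g Z Z' p n ω
      ≤ gridNorm (b - a) p (noiseTransform a b Z Z' n ω) + B / n) :
    Integrable (cramerError a b f g Z Z' p n) P ∧
      ∫ ω, cramerError a b f g Z Z' p n ω ∂P
        ≤ 30 * max 1 (b - a) * (b - a) * σ * (Real.log n ^ logExponent p / √n) + B / n := by
  have hL : 0 < b - a := sub_pos.2 hab
  have hn' : (0 : ℝ) < n := by exact_mod_cast (by omega : 0 < n)
  have hM : 0 < max 1 (b - a) := lt_max_of_lt_left one_pos
  have hl0 : 0 < noiseScale a b σ n := noiseScale_pos hab hσ (by omega)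
  have hlog : 0 ≤ Real.log n := Real.log_natCast_nonneg n
  obtain ⟨hint, hle⟩ := integrable_expSqMean_noiseTransform hab hσ hZ hn hne
  set c := max 1 (b - a) * (1 / √(noiseScale a b σ n)) * Real.log n ^ logExponent p with hc
  have hc0 : 0 ≤ c := by positivity
  have hbound : ∀ ω, cramerError a b f g Z Z' p n ω ≤ c * (1 + 2 * expSqMean (noiseScale a b σ n)
      (noiseTransform a b Z Z' n ω)) + B / n := fun ω =>
    (hB ω).trans (by gcongr; exact gridNorm_le_mul_expSqMean hL hl0 hp hn _)
  have hdom' : Integrable (fun ω => c * (1 + 2 * expSqMean (noiseScale a b σ n)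
      (noiseTransform a b Z Z' n ω))) P :=
    ((integrable_const 1).add (hint.const_mul 2)).const_mul c
  have hdom : Integrable (fun ω => c * (1 + 2 * expSqMean (noiseScale a b σ n)
      (noiseTransform a b Z Z' n ω)) + B / n) P := hdom'.add (integrable_const _)
  have herr : Integrable (cramerError a b f g Z Z' p n) P := by
    refine hdom.mono' (aemeasurable_cramerError hab f g (fun j => (hZ.law j).aemeasurable)
      (fun j => (hZ.law' j).aemeasurable) p hn).aestronglyMeasurable
      (Eventually.of_forall fun ω => ?_)
    have h0 : 0 ≤ cramerError a b f g Z Z' p n ω := abs_nonneg _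
    rw [Real.norm_of_nonneg h0]
    exact hbound ω
  refine ⟨herr, (integral_mono herr hdom hbound).trans ?_⟩
  rw [integral_add hdom' (integrable_const _), integral_const_mul, integral_add (integrable_const 1)
    (hint.const_mul 2), integral_const_mul, integral_const, integral_const]
  simp only [probReal_univ, one_smul]
  refine add_le_add ?_ le_rfl
  have hsqrt : √(noiseScale a b σ n) = √n / (6 * (b - a) * σ) := by
    rw [noiseScale, Real.sqrt_div hn'.le,
      show 36 * (b - a) ^ 2 * σ ^ 2 = (6 * (b - a) * σ) ^ 2 by ring, Real.sqrt_sq (by positivity)]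
  calc _ ≤ c * (1 + 2 * 2) := by gcongr
    _ = _ := by
      rw [hc, hsqrt]
      have : 0 < √(n : ℝ) := Real.sqrt_pos.2 hn'
      field_simp
      ring

/-- Borel–Cantelli: a random error whose tails at even lengths are dominated by
`A n exp (-B n t²)` tends to zero almost surely along the even lengths. -/
lemma ae_tendsto_zero_of_tail_bound {Ω : Type*} [MeasurableSpace Ω] {P : Measure Ω}
    [IsProbabilityMeasure P] {err : ℕ → Ω → ℝ} (h0 : ∀ n ω, 0 ≤ err n ω) {A B C : ℝ}
    (hA : 0 ≤ A) (hB : 0 < B)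
    (htail : ∀ t : ℝ, 0 ≤ t → ∀ n : ℕ, 2 ≤ n → Even n → C ≤ n * t →
      P.real {ω | t ≤ err n ω} ≤ A * n * Real.exp (-(B * (n * t ^ 2)))) :
    ∀ᵐ ω ∂P, Tendsto (fun m : ℕ => err (2 * m) ω) atTop (𝓝 0) := by
  have hev : ∀ k : ℕ, ∀ᵐ ω ∂P, ∀ᶠ m : ℕ in atTop, err (2 * m) ω < 1 / (k + 1 : ℝ) := by
    intro k
    set ε : ℝ := 1 / (k + 1 : ℝ) with hε
    have hε0 : 0 < ε := by positivity
    have hevC : ∀ᶠ m : ℕ in atTop, 1 ≤ m ∧ C ≤ (2 * m : ℕ) * ε := by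
      refine (eventually_ge_atTop 1).and ?_
      have : Tendsto (fun m : ℕ => ((2 * m : ℕ) : ℝ) * ε) atTop atTop := by
        refine Tendsto.atTop_mul_const hε0 (tendsto_natCast_atTop_atTop.comp ?_)
        exact tendsto_id.const_mul_atTop' two_pos
      exact this.eventually_ge_atTop C
    -- The tail bound is only available for large `m`; the other events are replaced by `∅`.
    let S : ℕ → Set Ω := fun m => {ω | (1 ≤ m ∧ C ≤ (2 * m : ℕ) * ε) ∧ ε ≤ err (2 * m) ω}
    have hS : ∀ m, P.real (S m) ≤ 2 * A * ((m : ℝ) ^ 1 * Real.exp (-(2 * B * ε ^ 2) * m)) := by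
      intro m
      by_cases hm : 1 ≤ m ∧ C ≤ (2 * m : ℕ) * ε
      · have h1 := htail ε hε0.le (2 * m) (by omega) (even_two_mul m) hm.2
        refine (measureReal_mono fun ω hω => hω.2).trans (h1.trans_eq ?_)
        push_cast
        rw [pow_one, show -(B * (2 * (m : ℝ) * ε ^ 2)) = -(2 * B * ε ^ 2) * m by ring]
        ring
      · have : S m = ∅ := Set.eq_empty_of_forall_notMem fun ω hω => hm hω.1
        rw [this, measureReal_empty]
        positivity
    have hsum : Summable fun m => P.real (S m) :=
      Summable.of_nonneg_of_le (fun m => measureReal_nonneg) hS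
        ((Real.summable_pow_mul_exp_neg_nat_mul 1 (by positivity)).mul_left _)
    have hne : ∑' m, P (S m) ≠ ∞ := by
      have h1 : ∀ m, P (S m) = ENNReal.ofReal (P.real (S m)) := fun m => by
        rw [ofReal_measureReal]
      simp only [h1]
      exact hsum.tsum_ofReal_ne_top
    filter_upwards [ae_eventually_notMem hne] with ω hω
    filter_upwards [hω, hevC] with m hm hmC
    by_contra hlt
    exact hm ⟨hmC, not_lt.1 hlt⟩
  filter_upwards [ae_all_iff.2 hev] with ω hω
  rw [Metric.tendsto_atTop']
  intro ε hε
  obtain ⟨k, hk⟩ := exists_nat_one_div_lt hε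
  obtain ⟨N, hN⟩ := eventually_atTop.1 (hω k)
  refine ⟨N, fun m hm => ?_⟩
  rw [Real.dist_eq, sub_zero, abs_of_nonneg (h0 _ _)]
  exact (hN m hm.le).trans hk

end

theorem theorem4p1 (a b : ℝ) (hab : a < b) (f g : ℝ → ℝ)
    (hf : ContDiff ℝ (⊤ : ℕ∞) f) (hg : ContDiff ℝ (⊤ : ℕ∞) g)
    (hf_supp : Function.support f ⊆ Set.Icc a b) (hg_supp : Function.support g ⊆ Set.Icc a b)
    (hfg : ∫ t in a..b, f t = ∫ t in a..b, g t) :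
    -- expected error
    (∃ A B : ℝ, 0 < A ∧ 0 < B ∧
      ∀ (Ω : Type u) [MeasurableSpace Ω] (P : Measure Ω) [IsProbabilityMeasure P]
        (Z Z' : ℕ → Ω → ℝ) (s s' : ℕ → ℝ≥0) (σ : ℝ), 0 ≤ σ →
        IsHeteroscedasticNoise P Z Z' s s' σ →
        ∀ n : ℕ, 2 ≤ n → Even n → ∀ p : ℝ≥0∞, 1 ≤ p →
          Integrable (cramerError a b f g Z Z' p n) P ∧
          ∫ ω, cramerError a b f g Z Z' p n ω ∂P
            ≤ A * σ * (Real.log n ^ logExponent p / √n) + B / n) ∧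
    -- concentration bound
    (∃ A B C : ℝ, 0 < A ∧ 0 < B ∧ 0 < C ∧
      ∀ (Ω : Type u) [MeasurableSpace Ω] (P : Measure Ω) [IsProbabilityMeasure P]
        (Z Z' : ℕ → Ω → ℝ) (s s' : ℕ → ℝ≥0) (σ : ℝ), 0 < σ →
        IsHeteroscedasticNoise P Z Z' s s' σ →
        ∀ t : ℝ, 0 ≤ t → ∀ n : ℕ, 2 ≤ n → Even n → C ≤ n * t →
          (∀ p : ℝ≥0∞, 1 ≤ p → p ≤ 2 →
            P.real {ω | t ≤ cramerError a b f g Z Z' p n ω}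
              ≤ A * Real.exp (-(B * (n * t ^ 2 / σ ^ 2)))) ∧
          (∀ p : ℝ≥0∞, 2 < p →
            P.real {ω | t ≤ cramerError a b f g Z Z' p n ω}
              ≤ A * n * Real.exp (-(B * (n * t ^ 2 / σ ^ 2))))) ∧
    -- almost sure limit (along the even lengths)
    (∀ (Ω : Type u) [MeasurableSpace Ω] (P : Measure Ω) [IsProbabilityMeasure P]
        (Z Z' : ℕ → Ω → ℝ) (s s' : ℕ → ℝ≥0) (σ : ℝ), 0 ≤ σ →
        IsHeteroscedasticNoise P Z Z' s s' σ →
        ∀ p : ℝ≥0∞, 1 ≤ p → ∀ᵐ ω ∂P,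
          Tendsto (fun m : ℕ => discreteCramerDist a b p
              (noisySamples a b f Z (2 * m) ω) (noisySamples a b g Z' (2 * m) ω))
            atTop (𝓝 (cramerDist a b p f g))) := by
  have hL : 0 < b - a := sub_pos.2 hab
  have hM : 0 < max 1 (b - a) := lt_max_of_lt_left one_pos
  obtain ⟨B, hB0, hB⟩ := exists_cramerError_le.{u} hab hf hg hf_supp hg_supp hfg
  -- For `2 B ≤ n t` the discretization error is at most `t / 2`, so that the noise has norm at least
  -- `t / 2`; then `D n t² / σ²` is the exponent `λ (t / (2 M))²`, where `M = max 1 L`.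
  set D := 1 / (144 * (b - a) ^ 2 * max 1 (b - a) ^ 2) with hD
  have hD0 : 0 < D := by positivity
  have htail_two : ∀ (Ω : Type u) [MeasurableSpace Ω] (P : Measure Ω) [IsProbabilityMeasure P]
      (Z Z' : ℕ → Ω → ℝ) (s s' : ℕ → ℝ≥0) (σ : ℝ), 0 < σ →
      IsHeteroscedasticNoise P Z Z' s s' σ →
      ∀ t : ℝ, 0 ≤ t → ∀ n : ℕ, 2 ≤ n → Even n → 2 * B ≤ n * t →
      ∀ p : ℝ≥0∞, 1 ≤ p → p ≤ 2 → P.real {ω | t ≤ cramerError a b f g Z Z' p n ω}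
        ≤ 2 * Real.exp (-(D * (n * t ^ 2 / σ ^ 2))) := by
    intro Ω _ P _ Z Z' s s' σ hσ hZ t ht n hn hne hBt p hp hp2
    have h := measureReal_le_cramerError_le hab hσ hZ hn hne (κ := 1) ht hBt
      (hB Ω Z Z' n hn p hp) (fun ω => by
        rw [one_mul]
        exact exp_gridNorm_sq_le_of_le_two hL (noiseScale_pos hab hσ (by omega)).le hp hp2
          (by omega) _) zero_le_one
    rwa [mul_one] at h
  have htail : ∀ (Ω : Type u) [MeasurableSpace Ω] (P : Measure Ω) [IsProbabilityMeasure P]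
      (Z Z' : ℕ → Ω → ℝ) (s s' : ℕ → ℝ≥0) (σ : ℝ), 0 < σ →
      IsHeteroscedasticNoise P Z Z' s s' σ →
      ∀ t : ℝ, 0 ≤ t → ∀ n : ℕ, 2 ≤ n → Even n → 2 * B ≤ n * t →
      ∀ p : ℝ≥0∞, 1 ≤ p → P.real {ω | t ≤ cramerError a b f g Z Z' p n ω}
        ≤ 2 * n * Real.exp (-(D * (n * t ^ 2 / σ ^ 2))) := by
    intro Ω _ P _ Z Z' s s' σ hσ hZ t ht n hn hne hBt p hp
    exact measureReal_le_cramerError_le hab hσ hZ hn hne ht hBt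
      (hB Ω Z Z' n hn p hp) (fun ω => exp_gridNorm_sq_le hL
        (noiseScale_pos hab hσ (by omega)).le hp (by omega) _) (Nat.cast_nonneg n)
  refine ⟨⟨30 * max 1 (b - a) * (b - a), B, by positivity, hB0, ?_⟩,
    ⟨2, D, 2 * B, two_pos, hD0, by positivity, ?_⟩, ?_⟩
  · intro Ω _ P _ Z Z' s s' σ hσ hZ n hn hne p hp
    -- The scale of the exponential moments requires `σ > 0`, so let `σ'` decrease to `σ`.
    have hσ' : ∀ σ' : ℝ, σ < σ' → _ := fun σ' h =>
      integral_cramerError_le hab (hσ.trans_lt h) (hZ.mono hσ h.le) hn hne hp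
        (hB Ω Z Z' n hn p hp)
    refine ⟨(hσ' (σ + 1) (lt_add_one σ)).1, ?_⟩
    refine ge_of_tendsto (f := fun σ' : ℝ => 30 * max 1 (b - a) * (b - a) * σ'
      * (Real.log n ^ logExponent p / √n) + B / n) (x := 𝓝[>] σ) ?_
      (eventually_mem_nhdsWithin.mono fun σ' h => (hσ' σ' h).2)
    exact Tendsto.mono_left (Continuous.tendsto (by fun_prop) σ) nhdsWithin_le_nhds
  · intro Ω _ P _ Z Z' s s' σ hσ hZ t ht n hn hne hC
    exact ⟨fun p hp hp2 => htail_two Ω P Z Z' s s' σ hσ hZ t ht n hn hne hC p hp hp2,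
      fun p hp => htail Ω P Z Z' s s' σ hσ hZ t ht n hn hne hC p
        (le_trans (by norm_num) hp.le)⟩
  · intro Ω _ P _ Z Z' s s' σ hσ hZ p hp
    have hσ1 : 0 < σ + 1 := by linarith
    have hlim := ae_tendsto_zero_of_tail_bound (P := P) (err := cramerError a b f g Z Z' p)
      (A := 2) (B := D / (σ + 1) ^ 2) (C := 2 * B) (fun n ω => abs_nonneg _) zero_le_two
      (by positivity) (fun t ht n hn hne hC => by
        refine (htail Ω P Z Z' s s' (σ + 1) hσ1 (hZ.mono hσ (by linarith)) t ht n hn hne hC p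
          hp).trans_eq ?_
        congr 3
        ring)
    filter_upwards [hlim] with ω hω
    rw [tendsto_iff_dist_tendsto_zero]
    exact hω
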